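/- **Conventions.** A weight matrix of size $N$ is a function $W$ that is smooth and almost everywhere positive definite on a nonempty open interval (possibly unbounded), is extended by $0$ to $\mathbb R$, takes values in $\mathrm{Mat}_N(\mathbb C)$ and has finite moments of all orders; a scalar weight is the case $N=1$. Put $\langle P,Q\rangle_W=\int P(x)W(x)Q(x)^*\,dx$ for matrix polynomials $P,Q$. A sequence of orthogonal polynomials for $W$ is a sequence $(P_n)_{n\ge 0}$ in $\mathrm{Mat}_N(\mathbb C[x])$ with $P_n$ of degree $n$, nonsingular leading coefficient and $\langle P_n,P_m\rangle_W=0$ for $n\ne m$. A differential operator $D=\sum_{j=0}^m\partial^jF_j(x)$ with $F_j\in\mathrm{Mat}_N(\mathbb C[x])$ acts on the right by $P\cdot D=\sum_j P^{(j)}F_j$; its order is the largest $j$ with $F_j\neq0$. $\mathcal D(W)$ is the set of such $D$ with $P_n\cdot D=\Lambda_nP_n$, $\Lambda_n\in\mathrm{Mat}_N(\mathbb C)$, for all $n\ge0$ (it does not depend on the choice of $(P_n)$). $W$ solves the Matrix Bochner Problem if $\mathcal D(W)$ contains an operator of order $2$. For the monic sequence $(P_n)$ of $W$ (with $P_m=0$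 for $m<0$), the right Fourier algebra $\mathcal F_R(W)$ is the set of such operators $\mathfrak D$ for which there are $\ell,k\ge0$ and matrices $A_j(n)$ with $P_n\cdot\mathfrak D=\sum_{j=-\ell}^kA_j(n)P_{n+j}$ for all $n\ge0$. A weight $W'$ with monic sequence $(P'_n)$ is a (bispectral) Darboux transformation of $W$ if there are $\mathfrak D,\mathfrak D'\in\mathcal F_R(W)$, polynomials $F,F'$ (scalar, or more generally matrix-valued with $\det F,\det F'\not\equiv0$) and matrices $C_n,C'_n$, nonsingular for all but finitely many $n$, such that for all $n\ge 0$ $$C_nP'_n=(P_n\cdot\mathfrak D)F^{-1},\qquad C'_nP_n=(P'_nF'^{-1})\cdot\mathfrak D'.$$ In a direct sum of scalar weights each summand may have its own interval; the notions above extend verbatim to such sums. **The weights.** Let $N\ge1$, let $a_1,\dots,a_{N-1}$ be nonzero real numbers, and put $T(x)=I+Ax$ with $$A=\sum_{j=1}^{[N/2]}a_{2j-1}E_{2j-1,2j}+\sum_{j=1}^{[(N-1)/2]}a_{2j}E_{2j+1,2j}.$$ Let $W(x)=T(x)\,\bigl(w_1(x)\oplus\cdots\oplus w_N(x)\bigr)\,T(x)^*$,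 where one of the following holds: - (Hermite, $W=W_H$) $w_j(x)=e^{-x^2+2b_jx}$ on $\mathbb R$, with $b_j\in\mathbb R$ and $b_i\ne b_j$ for $i\ne j$; - (Laguerre, $W=W_L$) $w_j(x)=e^{-x}x^{\alpha_j}$ on $(0,\infty)$, with $\alpha_j>-1$ and $\alpha_i-\alpha_j\notin\mathbb Z$ for $i\neq j$; - (Jacobi, $W=W_J$) $w_j(x)=(1-x)^{\alpha_j}(1+x)^{\beta_j}$ on $(-1,1)$, with $\alpha_j,\beta_j>-1$, with $\alpha_i-\alpha_j\notin\mathbb Z$ or $\beta_i-\beta_j\notin\mathbb Z$ for $i\ne j$, and with $\alpha_1+\beta_1=\alpha_j+\beta_j+1+(-1)^j$ for all $j=1,\dots,N$. **Theorem.** (i) $W$ solves the Matrix Bochner Problem. (ii) If $N\ge2$, then $W$ is not a Darboux transformation of any direct sum of $N$ scalar weights (in particular, of any direct sum of classical scalar weights). -/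

import Mathlib

open Polynomial MeasureTheory
open scoped ContDiff ComplexOrder

noncomputable section

namespace MatrixBochner

/-- `Mat_N(ℂ[x])`: matrix-valued polynomials, as matrices of polynomials. -/
abbrev MatPoly (N : ℕ) : Type := Matrix (Fin N) (Fin N) ℂ[X]

/-- Matrix-valued rational functions. -/
abbrev MatRat (N : ℕ) : Type := Matrix (Fin N) (Fin N) (RatFunc ℂ)

/-- The value `P(x)` of a matrix polynomial at a real point `x`. -/
def MatPoly.evalReal {N : ℕ} (P : MatPoly N) (x : ℝ) : Matrix (Fin N) (Fin N) ℂ :=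
  P.map (fun p => p.eval (x : ℂ))

/-- A constant matrix seen as a matrix polynomial. -/
def constPoly {N : ℕ} (M : Matrix (Fin N) (Fin N) ℂ) : MatPoly N := M.map Polynomial.C

/-- The coefficient matrix of `x ^ n`. -/
def MatPoly.coeffMat {N : ℕ} (P : MatPoly N) (n : ℕ) : Matrix (Fin N) (Fin N) ℂ :=
  P.map (fun p => p.coeff n)

/-- A matrix polynomial seen as a matrix of rational functions. -/
def toRat {N : ℕ} (P : MatPoly N) : MatRat N := P.map (algebraMap ℂ[X] (RatFunc ℂ))

/-- The derivative of a rational function, by the quotient rule. -/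
def ratDeriv (f : RatFunc ℂ) : RatFunc ℂ :=
  (algebraMap ℂ[X] (RatFunc ℂ) (derivative f.num * f.denom - f.num * derivative f.denom)) /
    (algebraMap ℂ[X] (RatFunc ℂ) (f.denom ^ 2))

/-! ### Weights -/

/-- `W` is a weight matrix of size `N`: smooth and almost everywhere positive definite on some
nonempty open interval, extended by zero to the whole line, and with finite moments of all
orders. -/
def IsWeightMatrix {N : ℕ} (W : ℝ → Matrix (Fin N) (Fin N) ℂ) : Prop :=
  (∃ I : Set ℝ, IsOpen I ∧ I.OrdConnected ∧ I.Nonempty ∧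
    (∀ i j, ContDiffOn ℝ ∞ (fun x => W x i j) I) ∧
    (∀ᵐ x ∂(volume.restrict I), (W x).PosDef) ∧
    (∀ x, x ∉ I → W x = 0)) ∧
  ∀ (n : ℕ) (i j : Fin N), Integrable (fun x : ℝ => ((x : ℂ) ^ n) * W x i j)

/-- A scalar weight is a weight matrix of size one. -/
def IsScalarWeight (w : ℝ → ℝ) : Prop :=
  IsWeightMatrix (N := 1) (fun x => Matrix.diagonal (fun _ => (w x : ℂ)))

/-- The direct sum `w₁ ⊕ ⋯ ⊕ w_N` of scalar functions. -/
def directSum {N : ℕ} (w : Fin N → ℝ → ℝ) (x : ℝ) : Matrix (Fin N) (Fin N) ℂ :=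
  Matrix.diagonal (fun i => (w i x : ℂ))

/-- `⟨P, Q⟩_W = ∫ P(x) W(x) Q(x)^* dx`, computed entrywise; `W` vanishes outside its interval. -/
def innerW {N : ℕ} (W : ℝ → Matrix (Fin N) (Fin N) ℂ) (P Q : MatPoly N) :
    Matrix (Fin N) (Fin N) ℂ :=
  Matrix.of fun i j => ∫ x : ℝ, (P.evalReal x * W x * (Q.evalReal x).conjTranspose) i j

/-- A sequence of orthogonal polynomials for `W`: `P n` has degree `n`, nonsingular leading
coefficient, and distinct members are orthogonal. -/
def IsOrthogonalSeq {N : ℕ} (W : ℝ → Matrix (Fin N) (Fin N) ℂ) (P : ℕ → MatPoly N) : Prop :=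
  (∀ n i j, (P n i j).natDegree ≤ n) ∧
  (∀ n, IsUnit ((P n).coeffMat n)) ∧
  (∀ n m, n ≠ m → innerW W (P n) (P m) = 0)

/-- The sequence of monic orthogonal polynomials for `W`. -/
def IsMonicOrthogonalSeq {N : ℕ} (W : ℝ → Matrix (Fin N) (Fin N) ℂ) (P : ℕ → MatPoly N) : Prop :=
  IsOrthogonalSeq W P ∧ ∀ n, (P n).coeffMat n = 1

/-! ### Differential operators -/

/-- `Mat_N(Ω[x])`: a differential operator `∑ⱼ ∂ʲ Fⱼ(x)` with polynomial coefficients is the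
finitely supported family of its coefficients `Fⱼ`. -/
abbrev DiffOp (N : ℕ) : Type := ℕ →₀ MatPoly N

/-- The right action `P · D = ∑ⱼ ∂ʲ(P) Fⱼ` on matrix polynomials. -/
def act {N : ℕ} (P : MatPoly N) (D : DiffOp N) : MatPoly N :=
  D.sum fun j F => P.map (fun p => derivative^[j] p) * F

/-- The right action `P · D = ∑ⱼ ∂ʲ(P) Fⱼ` on matrix-valued rational functions. -/
def actRat {N : ℕ} (P : MatRat N) (D : DiffOp N) : MatRat N :=
  D.sum fun j F => P.map (fun f => ratDeriv^[j] f) * toRat F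

/-- `D` has order exactly `m`. -/
def HasOrder {N : ℕ} (D : DiffOp N) (m : ℕ) : Prop :=
  D m ≠ 0 ∧ ∀ k, m < k → D k = 0

/-- The algebra `𝒟(W)`: operators having a sequence of orthogonal polynomials for `W` as
eigenfunctions, with matrix eigenvalues acting on the left. Two such sequences differ by
invertible left factors, so the choice of the sequence does not matter. -/
def algD {N : ℕ} (W : ℝ → Matrix (Fin N) (Fin N) ℂ) : Set (DiffOp N) :=
  {D | ∃ P : ℕ → MatPoly N, IsOrthogonalSeq W P ∧
    ∀ n, ∃ L : Matrix (Fin N) (Fin N) ℂ, act (P n) D = constPoly L * P n}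

/-- `W` solves the Matrix Bochner Problem. -/
def SolvesMatrixBochner {N : ℕ} (W : ℝ → Matrix (Fin N) (Fin N) ℂ) : Prop :=
  ∃ D ∈ algD W, HasOrder D 2

/-! ### Bispectral Darboux transformations -/

/-- The sequence `P`, extended by zero to negative indices. -/
def extSeq {N : ℕ} (P : ℕ → MatPoly N) (m : ℤ) : MatPoly N :=
  if 0 ≤ m then P m.toNat else 0

/-- The right Fourier algebra of the sequence `P`: operators `𝔇` such that
`P_n · 𝔇 = ∑_{j=-l}^{k} A_j(n) P_{n+j}` for some discrete operator with matrix coefficients. -/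
def rightFourier {N : ℕ} (P : ℕ → MatPoly N) : Set (DiffOp N) :=
  {D | ∃ (l k : ℕ) (A : ℤ → ℕ → Matrix (Fin N) (Fin N) ℂ),
    ∀ n : ℕ, act (P n) D =
      ∑ j ∈ Finset.Icc (-(l : ℤ)) (k : ℤ), constPoly (A j n) * extSeq P ((n : ℤ) + j)}

/-- `P'` is a bispectral Darboux transformation of `P`:
`C_n P'_n = P_n · 𝔇 F⁻¹` and `C'_n P_n = P'_n · F'⁻¹ 𝔇'`, with `𝔇, 𝔇'` in the right Fourier algebra
of `P` and `C_n, C'_n` nonsingular for all but finitely many `n`. The polynomials `F, F'` may be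
matrix-valued with nonzero determinant; a nonzero scalar polynomial `f` is the case `f • 1`. -/
def IsBispectralDarbouxSeq {N : ℕ} (P P' : ℕ → MatPoly N) : Prop :=
  ∃ (D D' : DiffOp N) (F F' : MatPoly N) (C C' : ℕ → Matrix (Fin N) (Fin N) ℂ),
    D ∈ rightFourier P ∧ D' ∈ rightFourier P ∧ F.det ≠ 0 ∧ F'.det ≠ 0 ∧
    (∀ᶠ n in Filter.atTop, IsUnit (C n)) ∧ (∀ᶠ n in Filter.atTop, IsUnit (C' n)) ∧
    (∀ n, toRat (constPoly (C n) * P' n) = toRat (act (P n) D) * (toRat F)⁻¹) ∧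
    (∀ n, toRat (constPoly (C' n) * P n) = actRat (toRat (P' n) * (toRat F')⁻¹) D')

/-- `W'` is a (bispectral) Darboux transformation of `W`. -/
def IsDarbouxTransformOf {N : ℕ} (W' W : ℝ → Matrix (Fin N) (Fin N) ℂ) : Prop :=
  ∃ P P' : ℕ → MatPoly N, IsMonicOrthogonalSeq W P ∧ IsMonicOrthogonalSeq W' P' ∧
    IsBispectralDarbouxSeq P P'

/-! ### The three families -/

/-- The Hermite weight `e^{-x²+2bx}` on the real line. -/
def hermiteWeight (b x : ℝ) : ℝ := Real.exp (-x ^ 2 + 2 * b * x)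

/-- The Laguerre weight `e^{-x} x^α` on `(0, ∞)`. -/
def laguerreWeight (α x : ℝ) : ℝ :=
  open Classical in if 0 < x then Real.exp (-x) * x ^ α else 0

/-- The Jacobi weight `(1-x)^α (1+x)^β` on `(-1, 1)`. -/
def jacobiWeight (α β x : ℝ) : ℝ :=
  open Classical in if -1 < x ∧ x < 1 then (1 - x) ^ α * (1 + x) ^ β else 0

/-- The matrix `A = ∑_{j=1}^{[N/2]} a_{2j-1} E_{2j-1,2j} + ∑_{j=1}^{[(N-1)/2]} a_{2j} E_{2j+1,2j}`.
The indices of `Fin N` start at zero, so that the row of `E_{2j-1,2j}` is the even number `2j-2`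
and the row of `E_{2j+1,2j}` is the even number `2j`. -/
def nilA (N : ℕ) (a : ℕ → ℝ) : Matrix (Fin N) (Fin N) ℂ :=
  Matrix.of fun r c =>
    if Even (r : ℕ) ∧ (c : ℕ) = (r : ℕ) + 1 then (a (c : ℕ) : ℂ)
    else if Even (r : ℕ) ∧ (r : ℕ) = (c : ℕ) + 1 then (a (r : ℕ) : ℂ)
    else 0

/-- `T(x) = I + A x`. -/
def matT (N : ℕ) (a : ℕ → ℝ) (x : ℝ) : Matrix (Fin N) (Fin N) ℂ :=
  1 + (x : ℂ) • nilA N a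

/-- `W(x) = T(x) (w₁(x) ⊕ ⋯ ⊕ w_N(x)) T(x)^*`. -/
def twisted {N : ℕ} (a : ℕ → ℝ) (w : Fin N → ℝ → ℝ) (x : ℝ) : Matrix (Fin N) (Fin N) ℂ :=
  matT N a x * directSum w x * (matT N a x).conjTranspose

/-- The parameters `a₁, …, a_{N-1}` are nonzero. -/
def NonzeroParams (N : ℕ) (a : ℕ → ℝ) : Prop := ∀ k, 1 ≤ k → k < N → a k ≠ 0

/-- The Hermite-type weights `W_H`. -/
def IsHermiteType {N : ℕ} (W : ℝ → Matrix (Fin N) (Fin N) ℂ) : Prop :=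
  ∃ (a : ℕ → ℝ) (b : Fin N → ℝ), NonzeroParams N a ∧
    (∀ i j, i ≠ j → b i ≠ b j) ∧
    W = twisted a (fun i => hermiteWeight (b i))

/-- The Laguerre-type weights `W_L`. -/
def IsLaguerreType {N : ℕ} (W : ℝ → Matrix (Fin N) (Fin N) ℂ) : Prop :=
  ∃ (a : ℕ → ℝ) (α : Fin N → ℝ), NonzeroParams N a ∧
    (∀ i, -1 < α i) ∧
    (∀ i j, i ≠ j → ∀ m : ℤ, α i - α j ≠ m) ∧
    W = twisted a (fun i => laguerreWeight (α i))

/-- The Jacobi-type weights `W_J`. With one-based indices the last condition on the parameters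
reads `α₁ + β₁ = α_j + β_j + 1 + (-1)^j` for all `j`. -/
def IsJacobiType {N : ℕ} (W : ℝ → Matrix (Fin N) (Fin N) ℂ) : Prop :=
  ∃ (a : ℕ → ℝ) (α β : Fin N → ℝ), NonzeroParams N a ∧
    (∀ i, -1 < α i) ∧ (∀ i, -1 < β i) ∧
    (∀ i j, i ≠ j → (∀ m : ℤ, α i - α j ≠ m) ∨ (∀ m : ℤ, β i - β j ≠ m)) ∧
    (∀ i j : Fin N, (i : ℕ) = 0 →
      α i + β i = α j + β j + 1 + (-1 : ℝ) ^ ((j : ℕ) + 1)) ∧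
    W = twisted a (fun i => jacobiWeight (α i) (β i))

end MatrixBochner

end

/-! Everything is transported to the diagonal. The matrix `A` has its nonzero entries in even rows
and odd columns (zero-based), so `A D A = 0` for every diagonal `D`, and `T = 1 + xA` has the
polynomial inverse `1 - xA`. With moment functionals `lⱼ`, the form of `W` on polynomial rows
becomes `∑ⱼ lⱼ((vT)ⱼ (uT)ⱼ)`, and analysis enters only through positivity and the Pearson equations
`(σ wⱼ)' = τⱼ wⱼ`.

For (i), conjugate by `T` the diagonal operator with entries `∂²σ + ∂τⱼ + cⱼ`. The Pearson equations
make the result symmetric. The relation between the leading coefficients of `σ` and the `τⱼ`,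
together with a choice of constants `cⱼ`, makes it preserve degrees. A symmetric operator that
preserves degrees acts on the orthogonal polynomials by matrices (`IsRowOrthogonal.eigen`).

For (ii), suppose that `W` is a Darboux transformation of a direct sum, whose monic polynomials `P
n` are diagonal. Passing from `P' n` to `P n`, projecting to the coordinate `s`, and passing back
gives a differential operator with eigenvalues `C'ₙ eₛ Cₙ`, of rank at most one
(`exists_rankOne_operators`). An operator with matrix eigenvalues has an adjoint. Conjugated to the
diagonal weight, its `(i, j)` entry is then adjointable between `w_j` and `w_i`, whose quotient is
not rational, so for `i ≠ j` this entry vanishes (`IsDiff.eq_zero_of_adjointable`). Thus every such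
operator is a conjugated diagonal one. Because `T` links the first two rows by `a₁x`, preservation
of degrees forces their diagonal eigenvalues to be `Q(n+1)` and `Q(n)` for one polynomial `Q`, and
the second row of the eigenvalue has no other entry (`exists_eigenvalue_symbol`). Rank one gives
`Q(n) Q(n+1) = 0`, so `Q = 0` and the second row of each `C'ₙ eₛ Cₙ` is zero. Summing over `s`
contradicts the invertibility of `C'ₙ Cₙ` for large `n` (`not_all_symbols`). -/

noncomputable section

namespace MatrixBochner

/-! ### Differential operators, characterised by commutators with multiplication by `X` -/

section IsDiff

variable {M M' M'' : Type*} [AddCommGroup M] [Module ℂ M] [Module ℂ[X] M] [SMulCommClass ℂ[X] ℂ M]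
  [AddCommGroup M'] [Module ℂ M'] [Module ℂ[X] M'] [SMulCommClass ℂ[X] ℂ M']
  [AddCommGroup M''] [Module ℂ M''] [Module ℂ[X] M''] [SMulCommClass ℂ[X] ℂ M'']

/-- The commutator of a linear map with multiplication by `X`. -/
def commX (L : M →ₗ[ℂ] M') : M →ₗ[ℂ] M' where
  toFun v := L ((X : ℂ[X]) • v) - (X : ℂ[X]) • L v
  map_add' u v := by simp only [smul_add, map_add]; abel
  map_smul' c v := by
    simp only [smul_comm (X : ℂ[X]) c, map_smul, smul_sub, RingHom.id_apply]

lemma commX_apply (L : M →ₗ[ℂ] M') (v : M) :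
    commX L v = L ((X : ℂ[X]) • v) - (X : ℂ[X]) • L v := rfl

lemma commX_zero : commX (0 : M →ₗ[ℂ] M') = 0 := by
  ext v; simp [commX_apply]

lemma commX_add (L K : M →ₗ[ℂ] M') : commX (L + K) = commX L + commX K := by
  ext v; simp only [commX_apply, LinearMap.add_apply, smul_add]; abel

lemma commX_comp (L : M' →ₗ[ℂ] M'') (K : M →ₗ[ℂ] M') :
    commX (L ∘ₗ K) = commX L ∘ₗ K + L ∘ₗ commX K := by
  ext v; simp [commX_apply]

/-- Linear maps between `ℂ[X]`-modules annihilated by some iterated commutator with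
multiplication by `X`. -/
inductive IsDiff : (M →ₗ[ℂ] M') → Prop
  | zero : IsDiff 0
  | step (L : M →ₗ[ℂ] M') : IsDiff (commX L) → IsDiff L

lemma IsDiff.commX {L : M →ₗ[ℂ] M'} (h : IsDiff L) : IsDiff (commX L) := by
  cases h with
  | zero => rw [commX_zero]; exact .zero
  | step _ h => exact h

lemma IsDiff.add {L K : M →ₗ[ℂ] M'} (hL : IsDiff L) (hK : IsDiff K) : IsDiff (L + K) := by
  induction hL generalizing K with
  | zero => simpa using hK
  | step L _ ih => exact .step _ (by rw [commX_add]; exact ih hK.commX)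

lemma IsDiff.sum {ι : Type*} (s : Finset ι) (L : ι → M →ₗ[ℂ] M') (h : ∀ i, IsDiff (L i)) :
    IsDiff (∑ i ∈ s, L i) := by
  classical
  induction s using Finset.induction_on with
  | empty => simpa using IsDiff.zero
  | insert i s hi ih => rw [Finset.sum_insert hi]; exact (h i).add ih

/-- The commutator is a derivation, `[LK, X] = [L, X]K + L[K, X]`, so each summand is shorter in one
of the two factors; hence the nested induction. -/
lemma IsDiff.comp {L : M' →ₗ[ℂ] M''} {K : M →ₗ[ℂ] M'} (hL : IsDiff L) (hK : IsDiff K) :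
    IsDiff (L ∘ₗ K) := by
  induction hL generalizing K with
  | zero => simpa using IsDiff.zero
  | step L hL ihL =>
    induction hK with
    | zero => simpa using IsDiff.zero
    | step K hK ihK => exact .step _ (by rw [commX_comp]; exact (ihL (.step _ hK)).add ihK)

lemma IsDiff.of_comm {L : M →ₗ[ℂ] M'} (h : ∀ v, L ((X : ℂ[X]) • v) = (X : ℂ[X]) • L v) :
    IsDiff L :=
  .step _ (by
    have : MatrixBochner.commX L = 0 := by ext v; simp [commX_apply, h]
    rw [this]; exact .zero)

lemma IsDiff.of_deriv {L : M →ₗ[ℂ] M} (h : ∀ v, L ((X : ℂ[X]) • v) = v + (X : ℂ[X]) • L v) :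
    IsDiff L :=
  .step _ (by
    have : MatrixBochner.commX L = LinearMap.id := by ext v; simp [commX_apply, h]
    rw [this]; exact .of_comm fun v => rfl)

lemma IsDiff.pow {L : M →ₗ[ℂ] M} (h : IsDiff L) (k : ℕ) : IsDiff (L ^ k) := by
  induction k with
  | zero => exact .of_comm fun v => rfl
  | succ k ih => rw [pow_succ]; exact ih.comp h

/-- Descent of `IsDiff` along an injective `X`-equivariant map. -/
lemma IsDiff.of_intertwine {ι : M →ₗ[ℂ] M'} (hι : Function.Injective ι)
    (hX : ∀ v, ι ((X : ℂ[X]) • v) = (X : ℂ[X]) • ι v) {L : M' →ₗ[ℂ] M'} {B : M →ₗ[ℂ] M}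
    (hL : IsDiff L) (h : ∀ v, ι (B v) = L (ι v)) : IsDiff B := by
  induction hL generalizing B with
  | zero =>
    have : B = 0 := by
      ext v; apply hι; simp [h]
    rw [this]; exact .zero
  | step L _ ih =>
    refine .step _ (ih fun v => ?_)
    simp only [commX_apply, map_sub, h, hX]

end IsDiff

/-- A linear map of `ℂ[X]` killed by an iterated commutator with `X` is a differential operator
with polynomial coefficients. -/
lemma IsDiff.exists_coeffs {E : ℂ[X] →ₗ[ℂ] ℂ[X]} (h : IsDiff E) :
    ∃ (m : ℕ) (f : ℕ → ℂ[X]), ∀ p, E p = ∑ k ∈ Finset.range m, f k * derivative^[k] p := by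
  induction h with
  | zero => exact ⟨0, fun _ => 0, fun p => by simp⟩
  | step E _ ih =>
    obtain ⟨m, g, hg⟩ := ih
    -- A formal antiderivative of the commutator: `[∂^(k+1), X] = (k+1)∂^k`, so `R` has the same
    -- commutator with `X` as `E`. The difference `E - R` commutes with `X` and is multiplication by
    -- its value at `1`.
    let R : ℂ[X] → ℂ[X] := fun p =>
      ∑ k ∈ Finset.range m, C ((k + 1 : ℂ)⁻¹) * g k * derivative^[k + 1] p
    have hR : ∀ p, R (X * p) = X * R p + ∑ k ∈ Finset.range m, g k * derivative^[k] p := by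
      intro p
      simp only [R, Finset.mul_sum, ← Finset.sum_add_distrib]
      refine Finset.sum_congr rfl fun k _ => ?_
      have h1 : derivative^[k + 1] (X * p)
          = X * derivative^[k + 1] p + (k + 1 : ℂ[X]) * derivative^[k] p := by
        rw [mul_comm X p, Polynomial.iterate_derivative_mul_X]
        simp [mul_comm]
      have h2 : C ((k + 1 : ℂ)⁻¹) * (k + 1 : ℂ[X]) = 1 := by
        have : (k + 1 : ℂ[X]) = C (k + 1 : ℂ) := by simp
        rw [this, ← C_mul, inv_mul_cancel₀ (Nat.cast_add_one_ne_zero k), C_1]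
      rw [h1]
      linear_combination (g k * derivative^[k] p) * h2
    have hE : ∀ p, E p = (E 1 - R 1) * p + R p := by
      have hX : ∀ p, E (X * p) - R (X * p) = X * (E p - R p) := by
        intro p
        have := hg p
        rw [commX_apply, smul_eq_mul, smul_eq_mul] at this
        rw [hR]; linear_combination this
      have hRlin : ∀ (p q : ℂ[X]), R (p + q) = R p + R q := by
        intro p q; simp only [R, ← Finset.sum_add_distrib, iterate_map_add, mul_add]
      have hRC : ∀ (c : ℂ) (q : ℂ[X]), R (C c * q) = C c * R q := by
        intro c q
        simp only [R, Finset.mul_sum, iterate_derivative_C_mul]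
        exact Finset.sum_congr rfl fun k _ => by ring
      intro p
      induction p using Polynomial.induction_on' with
      | add p q hp hq => rw [map_add, hp, hq, hRlin]; ring
      | monomial n c =>
        rw [← C_mul_X_pow_eq_monomial, ← smul_eq_C_mul, map_smul, smul_eq_C_mul, smul_eq_C_mul, hRC]
        suffices E (X ^ n) - R (X ^ n) = (E 1 - R 1) * X ^ n by linear_combination C c * this
        induction n with
        | zero => simp
        | succ n ih => rw [pow_succ', hX, ih]; ring
    refine ⟨m + 1, fun k => Nat.casesOn k (E 1 - R 1) fun k => C ((k + 1 : ℂ)⁻¹) * g k, fun p => ?_⟩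
    rw [Finset.sum_range_succ', hE p, add_comm]
    rfl

/-! ### The derivative of rational functions -/

/-- Differentiating the cross-multiplied identity shows that the quotient rule does not depend on
the fraction chosen; `ratDeriv` is defined through the reduced one. -/
lemma derivative_quotient_identity {a d p q : ℂ[X]} (h0 : a * q = p * d) :
    (derivative a * d - a * derivative d) * q ^ 2 =
      (derivative p * q - p * derivative q) * d ^ 2 := by
  have h1 := congrArg derivative h0
  rw [derivative_mul, derivative_mul] at h1
  linear_combination (q * d) * h1 - (derivative q * d + q * derivative d) * h0

lemma algebraMap_ratFunc_ne_zero {r : ℂ[X]} (hr : r ≠ 0) : algebraMap ℂ[X] (RatFunc ℂ) r ≠ 0 :=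
  fun h => hr (RatFunc.algebraMap_injective ℂ (h.trans (map_zero _).symm))

lemma ratDeriv_eq_of_eq_div {f : RatFunc ℂ} {p q : ℂ[X]} (hq : q ≠ 0)
    (hf : f = algebraMap ℂ[X] (RatFunc ℂ) p / algebraMap ℂ[X] (RatFunc ℂ) q) :
    ratDeriv f = algebraMap ℂ[X] (RatFunc ℂ) (derivative p * q - p * derivative q) /
        algebraMap ℂ[X] (RatFunc ℂ) (q ^ 2) := by
  have hd : f.denom ≠ 0 := RatFunc.denom_ne_zero f
  have h0 : f.num * q = p * f.denom := by
    apply RatFunc.algebraMap_injective ℂ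
    rw [map_mul, map_mul, ← div_eq_div_iff (algebraMap_ratFunc_ne_zero hd)
      (algebraMap_ratFunc_ne_zero hq), RatFunc.num_div_denom f, hf]
  unfold ratDeriv
  rw [div_eq_div_iff (algebraMap_ratFunc_ne_zero (pow_ne_zero 2 hd))
    (algebraMap_ratFunc_ne_zero (pow_ne_zero 2 hq)), ← map_mul, ← map_mul,
    derivative_quotient_identity h0]

lemma ratDeriv_div (p q : ℂ[X]) (hq : q ≠ 0) :
    ratDeriv (algebraMap ℂ[X] (RatFunc ℂ) p / algebraMap ℂ[X] (RatFunc ℂ) q) =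
      algebraMap ℂ[X] (RatFunc ℂ) (derivative p * q - p * derivative q) /
        algebraMap ℂ[X] (RatFunc ℂ) (q ^ 2) :=
  ratDeriv_eq_of_eq_div hq rfl

lemma ratDeriv_algebraMap (p : ℂ[X]) :
    ratDeriv (algebraMap ℂ[X] (RatFunc ℂ) p) = algebraMap ℂ[X] (RatFunc ℂ) (derivative p) := by
  have := ratDeriv_div p 1 one_ne_zero
  simpa using this

lemma ratDeriv_add (f g : RatFunc ℂ) : ratDeriv (f + g) = ratDeriv f + ratDeriv g := by
  have hd := RatFunc.denom_ne_zero f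
  have he := RatFunc.denom_ne_zero g
  conv_lhs => rw [← RatFunc.num_div_denom f, ← RatFunc.num_div_denom g]
  have hd' : algebraMap ℂ[X] (RatFunc ℂ) f.denom ≠ 0 := algebraMap_ratFunc_ne_zero hd
  have he' : algebraMap ℂ[X] (RatFunc ℂ) g.denom ≠ 0 := algebraMap_ratFunc_ne_zero he
  rw [div_add_div _ _ hd' he', ← map_mul, ← map_mul, ← map_mul, ← map_add,
    ratDeriv_div _ _ (mul_ne_zero hd he)]
  unfold ratDeriv
  simp only [derivative_mul, map_mul, map_sub, map_add, map_pow]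
  field_simp
  ring

lemma ratDeriv_mul (f g : RatFunc ℂ) : ratDeriv (f * g) = ratDeriv f * g + f * ratDeriv g := by
  have hd := RatFunc.denom_ne_zero f
  have he := RatFunc.denom_ne_zero g
  have hd' : algebraMap ℂ[X] (RatFunc ℂ) f.denom ≠ 0 := algebraMap_ratFunc_ne_zero hd
  have he' : algebraMap ℂ[X] (RatFunc ℂ) g.denom ≠ 0 := algebraMap_ratFunc_ne_zero he
  have hf := RatFunc.num_div_denom f
  have hg := RatFunc.num_div_denom g
  have h : ratDeriv (f * g) = ratDeriv (algebraMap ℂ[X] (RatFunc ℂ) (f.num * g.num) /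
      algebraMap ℂ[X] (RatFunc ℂ) (f.denom * g.denom)) := by
    rw [map_mul, map_mul, ← div_mul_div_comm, hf, hg]
  rw [h, ratDeriv_div _ _ (mul_ne_zero hd he)]
  have h2 : ratDeriv f * g + f * ratDeriv g = ratDeriv f * (algebraMap ℂ[X] (RatFunc ℂ) g.num /
      algebraMap ℂ[X] (RatFunc ℂ) g.denom) + (algebraMap ℂ[X] (RatFunc ℂ) f.num /
      algebraMap ℂ[X] (RatFunc ℂ) f.denom) * ratDeriv g := by rw [hf, hg]
  rw [h2]
  unfold ratDeriv
  simp only [derivative_mul, map_mul, map_sub, map_add, map_pow]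
  field_simp
  ring

/-- `ratDeriv` as a linear map. -/
def ratDerivL : RatFunc ℂ →ₗ[ℂ] RatFunc ℂ where
  toFun := ratDeriv
  map_add' := ratDeriv_add
  map_smul' c f := by
    have h : ∀ g : RatFunc ℂ, c • g = algebraMap ℂ[X] (RatFunc ℂ) (C c) * g := by
      intro g
      rw [Algebra.smul_def, IsScalarTower.algebraMap_apply ℂ ℂ[X] (RatFunc ℂ)]; rfl
    rw [RingHom.id_apply, h, h, ratDeriv_mul, ratDeriv_algebraMap]
    simp

lemma ratDeriv_iterate_algebraMap (k : ℕ) (p : ℂ[X]) :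
    ratDeriv^[k] (algebraMap ℂ[X] (RatFunc ℂ) p)
      = algebraMap ℂ[X] (RatFunc ℂ) (derivative^[k] p) := by
  induction k generalizing p with
  | zero => rfl
  | succ k ih => rw [Function.iterate_succ_apply, Function.iterate_succ_apply,
      ratDeriv_algebraMap, ih]

/-! ### Moment functionals -/

/-- Complex conjugation of the coefficients of a polynomial. -/
def conjPoly : ℂ[X] →+* ℂ[X] := Polynomial.mapRingHom (starRingEnd ℂ)

@[simp] lemma conjPoly_conjPoly (p : ℂ[X]) : conjPoly (conjPoly p) = p := by
  ext n; simp [conjPoly]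

@[simp] lemma conjPoly_X : conjPoly X = X := by simp [conjPoly]

@[simp] lemma conjPoly_C (c : ℂ) : conjPoly (C c) = C (starRingEnd ℂ c) := by simp [conjPoly]

lemma coeff_conjPoly (p : ℂ[X]) (n : ℕ) : (conjPoly p).coeff n = starRingEnd ℂ (p.coeff n) := by
  simp [conjPoly]

/-- A real, positive definite functional on polynomials. -/
structure IsPositive (l : ℂ[X] →ₗ[ℂ] ℂ) : Prop where
  real : ∀ p, l (conjPoly p) = starRingEnd ℂ (l p)
  nonneg : ∀ p, 0 ≤ (l (p * conjPoly p)).re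
  definite : ∀ p, l (p * conjPoly p) = 0 → p = 0

lemma IsPositive.eq_zero_of_mul {l : ℂ[X] →ₗ[ℂ] ℂ} (hl : IsPositive l) {p : ℂ[X]}
    (h : ∀ s, l (p * s) = 0) : p = 0 := hl.definite p (h _)

/-- The Pearson equation `(σ l)' = τ l` in weak form. -/
def IsPearson (σ τ : ℂ[X]) (l : ℂ[X] →ₗ[ℂ] ℂ) : Prop :=
  ∀ p, l (σ * derivative p + τ * p) = 0

/-- Integration by parts: every derivative moved off `p` uses up one factor `σ`, and `σ (σ^k s)'` is
still divisible by `σ^k`, so the induction continues. -/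
lemma IsPearson.exists_adjoint {σ τ : ℂ[X]} {l : ℂ[X] →ₗ[ℂ] ℂ} (hl : IsPearson σ τ l)
    (k : ℕ) (s : ℂ[X]) :
    ∃ h, ∀ p, l (derivative^[k] p * (σ ^ k * s)) = l (p * h) := by
  induction k generalizing s with
  | zero => exact ⟨s, fun p => by simp⟩
  | succ k ih =>
    obtain ⟨h, hh⟩ := ih (-(τ * s + (k * derivative σ * s + σ * derivative s)))
    refine ⟨h, fun p => ?_⟩
    rw [← hh p, ← sub_eq_zero, ← map_sub, ← hl (derivative^[k] p * (σ ^ k * s))]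
    congr 1
    have e : σ * derivative (σ ^ k * s) = σ ^ k * (k * derivative σ * s + σ * derivative s) := by
      rw [derivative_mul, derivative_pow]
      cases k with
      | zero => simp
      | succ k => simp only [Nat.add_sub_cancel, map_natCast]; ring
    rw [Function.iterate_succ_apply', derivative_mul]
    linear_combination -(derivative^[k] p) * e

/-- A power of `σ` at least as large as the order pays for all integrations by parts at once; it
depends on `E` only, not on `r`. -/
lemma IsDiff.exists_adjoint {E : ℂ[X] →ₗ[ℂ] ℂ[X]} (hE : IsDiff E) {σ τ : ℂ[X]}
    {l : ℂ[X] →ₗ[ℂ] ℂ} (hl : IsPearson σ τ l) :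
    ∃ m : ℕ, ∀ r, ∃ h, ∀ p, l (E p * (σ ^ m * r)) = l (p * h) := by
  obtain ⟨m, f, hf⟩ := hE.exists_coeffs
  refine ⟨m, fun r => ?_⟩
  have key : ∀ k, ∃ h, ∀ p, k < m → l (f k * derivative^[k] p * (σ ^ m * r)) = l (p * h) := by
    intro k
    obtain ⟨h, hh⟩ := hl.exists_adjoint k (σ ^ (m - k) * f k * r)
    refine ⟨h, fun p hk => ?_⟩
    rw [← hh p]
    congr 1
    have : σ ^ m = σ ^ k * σ ^ (m - k) := by rw [← pow_add]; congr 1; omega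
    rw [this]; ring
  choose h hh using key
  refine ⟨∑ k ∈ Finset.range m, h k, fun p => ?_⟩
  rw [hf, Finset.sum_mul, Finset.mul_sum, map_sum, map_sum]
  exact Finset.sum_congr rfl fun k hk => hh k p (Finset.mem_range.1 hk)

/-- A differential operator that is adjointable between two functionals whose quotient is not
rational vanishes. -/
lemma IsDiff.eq_zero_of_adjointable {E : ℂ[X] →ₗ[ℂ] ℂ[X]} (hE : IsDiff E) {σ τ τ' : ℂ[X]}
    {l l' : ℂ[X] →ₗ[ℂ] ℂ} (hσ : σ ≠ 0) (hl : IsPearson σ τ l) (hl' : IsPearson σ τ' l')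
    (hpos : IsPositive l)
    (hrat : ∀ g h : ℂ[X], σ * (derivative h * g - derivative g * h) + (τ - τ') * (g * h) = 0 →
      g = 0 ∨ h = 0)
    (hadj : ∀ q, ∃ g, ∀ p, l (E p * q) = l' (p * g)) : E = 0 := by
  obtain ⟨m, hm⟩ := hE.exists_adjoint hl
  have key : ∀ p r, l (E p * (σ ^ m * r)) = 0 := by
    intro p r
    obtain ⟨h, hh⟩ := hm r
    obtain ⟨g, hg⟩ := hadj (σ ^ m * r)
    have hu : ∀ p, l (p * h) = l' (p * g) := fun p => by rw [← hh, hg]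
    -- The two adjoints say that `h l = g l'` as functionals. Testing both Pearson equations on
    -- multiples of `gh` and subtracting expresses that `h/g` would be the quotient of the two
    -- weights; the extra factor `h` allows the passage from `l'` to `l`.
    have hz : (σ * (derivative h * g - derivative g * h) + (τ - τ') * (g * h)) * h = 0 := by
      refine hpos.eq_zero_of_mul fun s => ?_
      have h1 := hl (h * g * s * h)
      have h2 := hl' (g * h * s * g)
      have e1 : σ * derivative (h * g * s * h) + τ * (h * g * s * h) =
          (σ * (2 * derivative h * g * s + h * derivative g * s + h * g * derivative s) +
            τ * (h * g * s)) * h := by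
        simp only [derivative_mul]; ring
      have e2 : σ * derivative (g * h * s * g) + τ' * (g * h * s * g) =
          (σ * (2 * derivative g * h * s + g * derivative h * s + g * h * derivative s) +
            τ' * (g * h * s)) * g := by
        simp only [derivative_mul]; ring
      rw [e1] at h1
      rw [e2, ← hu] at h2
      have h3 : l ((σ * (2 * derivative h * g * s + h * derivative g * s + h * g * derivative s) +
            τ * (h * g * s)) * h - (σ * (2 * derivative g * h * s + g * derivative h * s +
            g * h * derivative s) + τ' * (g * h * s)) * h) = 0 := by
        rw [map_sub, h1, h2, sub_zero]
      rw [← h3]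
      congr 1
      ring
    rcases mul_eq_zero.1 hz with h0 | h0
    · rcases hrat g h h0 with h0 | h0
      · rw [hg, h0, mul_zero, map_zero]
      · rw [hh, h0, mul_zero, map_zero]
    · rw [hh, h0, mul_zero, map_zero]
  ext1 p
  have h0 : ∀ q, E q = 0 := by
    intro q
    have : E q * σ ^ m = 0 := hpos.eq_zero_of_mul fun s => by rw [mul_assoc]; exact key q s
    exact (mul_eq_zero.1 this).resolve_right (pow_ne_zero _ hσ)
  exact LinearMap.ext fun _ => by simp [h0]

/-! ### Rows of polynomials and the bilinear form of a weight -/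

/-- Row vectors of polynomials. -/
abbrev PolyRow (N : ℕ) : Type := Fin N → ℂ[X]

variable {N : ℕ}

/-- Entrywise conjugation. -/
def conjRow (v : PolyRow N) : PolyRow N := fun i => conjPoly (v i)

@[simp] lemma conjRow_conjRow (v : PolyRow N) : conjRow (conjRow v) = v := by
  ext1 i; simp [conjRow]

lemma conjRow_vecMul (v : PolyRow N) {T : MatPoly N} (hT : T.map conjPoly = T) :
    conjRow (Matrix.vecMul v T) = Matrix.vecMul (conjRow v) T := by
  ext1 j
  conv_rhs => rw [← hT]
  simp [conjRow, Matrix.vecMul, dotProduct]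

/-- All entries have degree less than `n`. -/
def RowDegLT (n : ℕ) (v : PolyRow N) : Prop := ∀ i, (v i).degree < n

lemma RowDegLT.coeff {n m : ℕ} {v : PolyRow N} (h : RowDegLT n v) (hm : n ≤ m) (i : Fin N) :
    (v i).coeff m = 0 :=
  coeff_eq_zero_of_degree_lt ((h i).trans_le (by exact_mod_cast hm))

lemma rowDegLT_iff {n : ℕ} {v : PolyRow N} :
    RowDegLT n v ↔ ∀ i m, n ≤ m → (v i).coeff m = 0 := by
  refine ⟨fun h i m hm => h.coeff hm i, fun h i => ?_⟩
  exact (degree_lt_iff_coeff_zero _ _).2 (h i)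

lemma RowDegLT.mono {n m : ℕ} {v : PolyRow N} (h : RowDegLT n v) (hm : n ≤ m) : RowDegLT m v :=
  fun i => (h i).trans_le (by exact_mod_cast hm)

lemma RowDegLT.conj {n : ℕ} {v : PolyRow N} (h : RowDegLT n v) : RowDegLT n (conjRow v) := by
  rw [rowDegLT_iff] at h ⊢
  intro i m hm
  simp [conjRow, coeff_conjPoly, h i m hm]

lemma RowDegLT.add {n : ℕ} {u v : PolyRow N} (hu : RowDegLT n u) (hv : RowDegLT n v) :
    RowDegLT n (u + v) := by
  rw [rowDegLT_iff] at *
  intro i m hm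
  simp [hu i m hm, hv i m hm]

lemma RowDegLT.smul {n : ℕ} {v : PolyRow N} (c : ℂ) (hv : RowDegLT n v) : RowDegLT n (c • v) := by
  rw [rowDegLT_iff] at *
  intro i m hm
  simp [hv i m hm]

lemma RowDegLT.sub {n : ℕ} {u v : PolyRow N} (hu : RowDegLT n u) (hv : RowDegLT n v) :
    RowDegLT n (u - v) := by
  rw [rowDegLT_iff] at *
  intro i m hm
  simp [hu i m hm, hv i m hm]

lemma rowDegLT_zero (n : ℕ) : RowDegLT n (0 : PolyRow N) := by
  rw [rowDegLT_iff]; simp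

lemma RowDegLT.sum {n : ℕ} {ι : Type*} (s : Finset ι) {v : ι → PolyRow N}
    (hv : ∀ i, RowDegLT n (v i)) : RowDegLT n (∑ i ∈ s, v i) := by
  rw [rowDegLT_iff]
  intro i m hm
  simp [fun j => (hv j).coeff hm i]

lemma exists_rowDegLT (v : PolyRow N) : ∃ n, RowDegLT n v := by
  refine ⟨(Finset.univ.sup fun i => (v i).natDegree) + 1, fun i => ?_⟩
  refine degree_le_natDegree.trans_lt ?_
  exact_mod_cast Nat.lt_succ_of_le (Finset.le_sup (f := fun i => (v i).natDegree)
    (Finset.mem_univ i))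

/-- The bilinear form `(v, u) ↦ ∑ⱼ lⱼ((vT)ⱼ (uT)ⱼ)`. -/
def rowForm (l : Fin N → ℂ[X] →ₗ[ℂ] ℂ) (T : MatPoly N) :
    PolyRow N →ₗ[ℂ] PolyRow N →ₗ[ℂ] ℂ :=
  LinearMap.mk₂ ℂ (fun v u => ∑ j, l j (Matrix.vecMul v T j * Matrix.vecMul u T j))
    (fun v v' u => by
      simp only [Matrix.add_vecMul, Pi.add_apply, add_mul, map_add, Finset.sum_add_distrib])
    (fun c v u => by
      simp only [Matrix.smul_vecMul, Pi.smul_apply, smul_mul_assoc, map_smul, Finset.smul_sum])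
    (fun v u u' => by
      simp only [Matrix.add_vecMul, Pi.add_apply, mul_add, map_add, Finset.sum_add_distrib])
    (fun c v u => by
      simp only [Matrix.smul_vecMul, Pi.smul_apply, mul_smul_comm, map_smul, Finset.smul_sum])

lemma rowForm_apply (l : Fin N → ℂ[X] →ₗ[ℂ] ℂ) (T : MatPoly N) (v u : PolyRow N) :
    rowForm l T v u = ∑ j, l j (Matrix.vecMul v T j * Matrix.vecMul u T j) := rfl

lemma rowForm_comm (l : Fin N → ℂ[X] →ₗ[ℂ] ℂ) (T : MatPoly N) (v u : PolyRow N) :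
    rowForm l T v u = rowForm l T u v := by
  simp only [rowForm_apply, mul_comm]

/-- The data of a weight `T diag(w) T^*` on the level of moments. -/
structure IsFactored (l : Fin N → ℂ[X] →ₗ[ℂ] ℂ) (T T' : MatPoly N) : Prop where
  pos : ∀ j, IsPositive (l j)
  real : T.map conjPoly = T
  mul_inv : T * T' = 1

section Form

variable {l : Fin N → ℂ[X] →ₗ[ℂ] ℂ} {T T' : MatPoly N}

lemma IsFactored.inv_mul (h : IsFactored l T T') : T' * T = 1 :=
  mul_eq_one_comm.1 h.mul_inv

lemma IsFactored.definite (h : IsFactored l T T') {v : PolyRow N}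
    (hv : rowForm l T v (conjRow v) = 0) : v = 0 := by
  rw [rowForm_apply, ← conjRow_vecMul v h.real] at hv
  have h1 : ∑ j, (l j (Matrix.vecMul v T j * conjPoly (Matrix.vecMul v T j))).re = 0 := by
    rw [← Complex.re_sum]; exact (congrArg Complex.re hv).trans Complex.zero_re
  rw [Finset.sum_eq_zero_iff_of_nonneg fun j _ => (h.pos j).nonneg _] at h1
  have h2 : Matrix.vecMul v T = 0 := by
    ext1 j
    refine (h.pos j).definite _ (Complex.ext (h1 j (Finset.mem_univ j)) ?_)
    -- The argument is fixed by conjugation, so its value is real; the vanishing of the real part is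
    -- then enough.
    have := (h.pos j).real (Matrix.vecMul v T j * conjPoly (Matrix.vecMul v T j))
    rw [map_mul, conjPoly_conjPoly, mul_comm] at this
    exact Complex.conj_eq_iff_im.1 this.symm
  calc v = Matrix.vecMul (Matrix.vecMul v T) T' := by
        rw [Matrix.vecMul_vecMul, h.mul_inv, Matrix.vecMul_one]
    _ = 0 := by rw [h2, Matrix.zero_vecMul]

lemma IsFactored.conj (h : IsFactored l T T') (v u : PolyRow N) :
    rowForm l T (conjRow v) (conjRow u) = starRingEnd ℂ (rowForm l T v u) := by
  rw [rowForm_apply, rowForm_apply, ← conjRow_vecMul v h.real, ← conjRow_vecMul u h.real, map_sum]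
  refine Finset.sum_congr rfl fun j _ => ?_
  rw [← (h.pos j).real, map_mul conjPoly]; rfl

/-- Riesz representation on rows of degree less than `n`. -/
lemma IsFactored.exists_repr (h : IsFactored l T T') (n : ℕ) (φ : PolyRow N →ₗ[ℂ] ℂ) :
    ∃ g, RowDegLT n g ∧ ∀ v, RowDegLT n v → φ v = rowForm l T v g := by
  let U := Fin N → degreeLT ℂ n
  let ι : U →ₗ[ℂ] PolyRow N := LinearMap.pi fun i => (degreeLT ℂ n).subtype ∘ₗ LinearMap.proj i
  have : FiniteDimensional ℂ (degreeLT ℂ n) := (degreeLTEquiv ℂ n).symm.finiteDimensional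
  have hι : ∀ u : U, RowDegLT n (ι u) := fun u i => mem_degreeLT.1 (u i).2
  have hι' : ∀ v : PolyRow N, RowDegLT n v → ∃ u : U, ι u = v := fun v hv =>
    ⟨fun i => ⟨v i, mem_degreeLT.2 (hv i)⟩, rfl⟩
  let Φ : U →ₗ[ℂ] Module.Dual ℂ U := (rowForm l T).compl₁₂ ι ι
  -- The form is bilinear, not sesquilinear. It is nondegenerate in each degree because the
  -- conjugate of a row has the same degree and is available as a test row.
  have hinj : Function.Injective Φ := by
    rw [← LinearMap.ker_eq_bot, LinearMap.ker_eq_bot']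
    intro u hu
    obtain ⟨u', hu'⟩ := hι' _ (hι u).conj
    have h1 : rowForm l T (ι u) (ι u') = 0 := LinearMap.congr_fun hu u'
    rw [hu'] at h1
    have h2 := h.definite h1
    ext1 i
    exact Subtype.ext (congrFun h2 i)
  have hsurj : Function.Surjective Φ :=
    (LinearMap.injective_iff_surjective_of_finrank_eq_finrank
      Subspace.dual_finrank_eq.symm).1 hinj
  obtain ⟨u, hu⟩ := hsurj (φ ∘ₗ ι)
  refine ⟨ι u, hι u, fun v hv => ?_⟩
  obtain ⟨u', rfl⟩ := hι' v hv
  rw [rowForm_comm]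
  exact (LinearMap.congr_fun hu u').symm

end Form

/-! ### Monic sequences of matrix polynomials -/

/-- `P n` is monic of degree `n`. -/
def IsMonicSeq (P : ℕ → MatPoly N) : Prop :=
  (∀ n i j, (P n i j).natDegree ≤ n) ∧ ∀ n, (P n).coeffMat n = 1

lemma IsMonicSeq.rowDegLT {P : ℕ → MatPoly N} (hP : IsMonicSeq P) (n : ℕ) (i : Fin N) :
    RowDegLT (n + 1) (P n i) := by
  rw [rowDegLT_iff]
  intro j m hm
  exact coeff_eq_zero_of_natDegree_lt ((hP.1 n i j).trans_lt hm)

lemma IsMonicSeq.coeff {P : ℕ → MatPoly N} (hP : IsMonicSeq P) (n : ℕ) (i j : Fin N) :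
    (P n i j).coeff n = (1 : Matrix (Fin N) (Fin N) ℂ) i j := by
  rw [← hP.2 n]; rfl

lemma IsMonicSeq.coeff_sum {P : ℕ → MatPoly N} (hP : IsMonicSeq P) (n : ℕ) (c : Fin N → ℂ)
    (j : Fin N) : ((∑ k, c k • P n k : PolyRow N) j).coeff n = c j := by
  simp [finsetSum_coeff, hP.coeff, Matrix.one_apply]

/-- Removing the leading coefficient. -/
lemma IsMonicSeq.sub_rowDegLT {P : ℕ → MatPoly N} (hP : IsMonicSeq P) {n : ℕ} {v : PolyRow N}
    (hv : RowDegLT (n + 1) v) : RowDegLT n (v - ∑ k, (v k).coeff n • P n k) := by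
  have h := hv.sub (RowDegLT.sum Finset.univ fun k => (hP.rowDegLT n k).smul ((v k).coeff n))
  rw [rowDegLT_iff] at h ⊢
  intro i m hm
  rcases hm.eq_or_lt with rfl | hm
  · rw [Pi.sub_apply, coeff_sub, hP.coeff_sum, sub_self]
  · exact h i m hm

/-- The rows of `P 0, …, P (n-1)` span the rows of degree less than `n`, since leading coefficients
can be removed one degree at a time. Linear statements therefore need checking only on the sequence.
-/
lemma IsMonicSeq.mem_of_rowDegLT {P : ℕ → MatPoly N} (hP : IsMonicSeq P)
    (S : Submodule ℂ (PolyRow N)) {n : ℕ} (hS : ∀ m < n, ∀ i, P m i ∈ S) {v : PolyRow N}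
    (hv : RowDegLT n v) : v ∈ S := by
  induction n generalizing v with
  | zero =>
    have : v = 0 := by
      ext i m; simpa using hv.coeff (Nat.zero_le m) i
    rw [this]; exact S.zero_mem
  | succ n ih =>
    have h := ih (fun m hm => hS m (hm.trans n.lt_succ_self)) (hP.sub_rowDegLT hv)
    have h2 : ∑ k, (v k).coeff n • P n k ∈ S :=
      S.sum_mem fun k _ => S.smul_mem _ (hS n n.lt_succ_self k)
    simpa using S.add_mem h h2

/-- Linear maps that multiply a monic sequence by matrices preserve degrees, with the matrix as
action on leading coefficients. -/
lemma IsMonicSeq.eigen_rowDegLT {P : ℕ → MatPoly N} (hP : IsMonicSeq P)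
    {B : PolyRow N →ₗ[ℂ] PolyRow N} {M : ℕ → Matrix (Fin N) (Fin N) ℂ}
    (hB : ∀ n i, B (P n i) = ∑ k, M n i k • P n k) {n : ℕ} {v : PolyRow N}
    (hv : RowDegLT n v) : RowDegLT n (B v) := by
  let S : Submodule ℂ (PolyRow N) :=
    { carrier := {v | RowDegLT n (B v)}
      add_mem' := fun {u v} hu hv => by
        simp only [Set.mem_ofPred_eq, map_add] at *; exact hu.add hv
      zero_mem' := by simp only [Set.mem_ofPred_eq, map_zero]; exact rowDegLT_zero n
      smul_mem' := fun c v hv => by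
        simp only [Set.mem_ofPred_eq, map_smul] at *; exact hv.smul c }
  refine hP.mem_of_rowDegLT S (fun m hm i => ?_) hv
  change RowDegLT n (B (P m i))
  rw [hB]
  exact RowDegLT.sum _ fun k => ((hP.rowDegLT m k).mono hm).smul _

/-- The part of `v` of degree below `n` stays there, so only leading coefficients contribute. The
eigenvalues can thus be read off on monomial rows, without knowing `P n`. -/
lemma IsMonicSeq.eigen_coeff {P : ℕ → MatPoly N} (hP : IsMonicSeq P)
    {B : PolyRow N →ₗ[ℂ] PolyRow N} {M : ℕ → Matrix (Fin N) (Fin N) ℂ}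
    (hB : ∀ n i, B (P n i) = ∑ k, M n i k • P n k) (n : ℕ) {v : PolyRow N}
    (hv : RowDegLT (n + 1) v) (j : Fin N) :
    (B v j).coeff n = ∑ i, (v i).coeff n * M n i j := by
  have h := (hP.eigen_rowDegLT hB (hP.sub_rowDegLT hv)).coeff le_rfl j
  rw [map_sub, Pi.sub_apply, coeff_sub, sub_eq_zero] at h
  rw [h, map_sum, Finset.sum_apply, finsetSum_coeff]
  refine Finset.sum_congr rfl fun i _ => ?_
  rw [map_smul, hB, Pi.smul_apply, coeff_smul, hP.coeff_sum, smul_eq_mul]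

section Orthogonal

variable {l : Fin N → ℂ[X] →ₗ[ℂ] ℂ} {T T' : MatPoly N}

/-- Each row of `P n` is orthogonal to everything of smaller degree. -/
def IsRowOrthogonal (l : Fin N → ℂ[X] →ₗ[ℂ] ℂ) (T : MatPoly N) (P : ℕ → MatPoly N) : Prop :=
  ∀ n i v, RowDegLT n v → rowForm l T (P n i) v = 0

lemma isRowOrthogonal_of_pairwise {P : ℕ → MatPoly N} (hP : IsMonicSeq P)
    (h : ∀ n m, n ≠ m → ∀ i k, rowForm l T (P n i) (conjRow (P m k)) = 0) :
    IsRowOrthogonal l T P := by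
  intro n i v hv
  let S : Submodule ℂ (PolyRow N) :=
    { carrier := {v | rowForm l T (P n i) (conjRow v) = 0}
      add_mem' := fun {u v} hu hv => by
        have : conjRow (u + v) = conjRow u + conjRow v := by ext1; simp [conjRow]
        simp only [Set.mem_ofPred_eq, this, map_add] at *; rw [hu, hv, add_zero]
      zero_mem' := by
        have : conjRow (0 : PolyRow N) = 0 := by ext1; simp [conjRow]
        simp only [Set.mem_ofPred_eq, this, map_zero]
      smul_mem' := fun c v hv => by
        have : conjRow (c • v) = starRingEnd ℂ c • conjRow v := by
          ext1; simp [conjRow, smul_eq_C_mul]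
        simp only [Set.mem_ofPred_eq, this, map_smul] at *; rw [hv, smul_zero] }
  have := hP.mem_of_rowDegLT S (fun m hm k => h n m hm.ne' i k) hv.conj
  change rowForm l T (P n i) (conjRow (conjRow v)) = 0 at this
  rwa [conjRow_conjRow] at this

lemma IsRowOrthogonal.pairwise {P : ℕ → MatPoly N} (h : IsFactored l T T') (hP : IsMonicSeq P)
    (ho : IsRowOrthogonal l T P) {n m : ℕ} (hnm : n ≠ m) (i k : Fin N) :
    rowForm l T (P n i) (conjRow (P m k)) = 0 := by
  rcases hnm.lt_or_gt with hlt | hlt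
  · have h1 := ho m k (conjRow (P n i)) ((hP.rowDegLT n i).mono hlt).conj
    have h2 := h.conj (P m k) (conjRow (P n i))
    rw [h1, conjRow_conjRow, map_zero] at h2
    rw [rowForm_comm, h2]
  · exact ho n i _ ((hP.rowDegLT m k).mono hlt).conj

/-- Gram–Schmidt: subtract from `xⁿ eᵢ` the row of degree less than `n` that represents the same
functional there. -/
lemma IsFactored.exists_monicSeq (h : IsFactored l T T') :
    ∃ P : ℕ → MatPoly N, IsMonicSeq P ∧ IsRowOrthogonal l T P := by
  have hx : ∀ (n : ℕ) (i : Fin N), ∃ g, RowDegLT n g ∧ ∀ v, RowDegLT n v →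
      rowForm l T v (Pi.single i (X ^ n)) = rowForm l T v g := fun n i =>
    h.exists_repr n ((rowForm l T).flip (Pi.single i (X ^ n)))
  choose g hg1 hg2 using hx
  refine ⟨fun n => Matrix.of fun i => (Pi.single i (X ^ n) - g n i : PolyRow N), ⟨?_, ?_⟩, ?_⟩
  · intro n i j
    rw [natDegree_le_iff_coeff_eq_zero]
    intro m hm
    change ((Pi.single i (X ^ n) - g n i : PolyRow N) j).coeff m = 0
    rw [Pi.sub_apply, coeff_sub, (hg1 n i).coeff hm.le, sub_zero]
    by_cases hij : j = i
    · subst hij; rw [Pi.single_eq_same, coeff_X_pow, if_neg hm.ne']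
    · rw [Pi.single_eq_of_ne hij, coeff_zero]
  · intro n
    ext i j
    change ((Pi.single i (X ^ n) - g n i : PolyRow N) j).coeff n = _
    rw [Pi.sub_apply, coeff_sub, (hg1 n i).coeff le_rfl, sub_zero]
    by_cases hij : j = i
    · subst hij; rw [Pi.single_eq_same, coeff_X_pow, if_pos rfl, Matrix.one_apply_eq]
    · rw [Pi.single_eq_of_ne hij, coeff_zero, Matrix.one_apply_ne (Ne.symm hij)]
  · intro n i v hv
    exact ((rowForm_comm l T _ v).trans ((rowForm l T v).map_sub _ _)).trans
      (sub_eq_zero.2 (hg2 n i v hv))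

/-- Symmetric operators that preserve degrees act on orthogonal polynomials by matrices. -/
lemma IsRowOrthogonal.eigen {P : ℕ → MatPoly N} (h : IsFactored l T T') (hP : IsMonicSeq P)
    (ho : IsRowOrthogonal l T P) {B : PolyRow N →ₗ[ℂ] PolyRow N}
    (hsymm : ∀ v u, rowForm l T (B v) u = rowForm l T v (B u))
    (hdeg : ∀ n v, RowDegLT n v → RowDegLT n (B v)) (n : ℕ) (i : Fin N) :
    B (P n i) = ∑ k, (B (P n i) k).coeff n • P n k := by
  have hd := hP.sub_rowDegLT (hdeg _ _ (hP.rowDegLT n i))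
  -- The remainder has degree less than `n`. By symmetry it is also orthogonal to all rows of degree
  -- less than `n`, in particular to its own conjugate.
  rw [← sub_eq_zero]
  apply h.definite
  rw [map_sub, LinearMap.sub_apply, hsymm, ho n i _ (hdeg _ _ hd.conj), map_sum,
    LinearMap.sum_apply, Finset.sum_eq_zero, sub_zero]
  intro k _
  rw [map_smul, LinearMap.smul_apply, ho n k _ hd.conj, smul_zero]

/-- Operators acting on orthogonal polynomials by matrices are adjointable. -/
lemma IsRowOrthogonal.exists_adjoint {P : ℕ → MatPoly N} (h : IsFactored l T T')
    (hP : IsMonicSeq P) (ho : IsRowOrthogonal l T P) {B : PolyRow N →ₗ[ℂ] PolyRow N}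
    {M : ℕ → Matrix (Fin N) (Fin N) ℂ}
    (hB : ∀ n i, B (P n i) = ∑ k, M n i k • P n k) (u : PolyRow N) :
    ∃ g, ∀ v, rowForm l T (B v) u = rowForm l T v g := by
  -- The functional `v ↦ ⟨Bv, u⟩` vanishes on the rows of `P m` for `m ≥ d`, so a representing row
  -- of degree less than `d` represents it on all rows.
  obtain ⟨d, hd⟩ := exists_rowDegLT u
  obtain ⟨g, hg, hrep⟩ := h.exists_repr d ((rowForm l T).flip u ∘ₗ B)
  refine ⟨g, fun v => ?_⟩
  obtain ⟨n, hn⟩ := exists_rowDegLT v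
  have hmem : v ∈ LinearMap.ker ((rowForm l T).flip u ∘ₗ B - (rowForm l T).flip g) := by
    refine hP.mem_of_rowDegLT _ (fun m _ i => ?_) hn
    rw [LinearMap.mem_ker, LinearMap.sub_apply, sub_eq_zero]
    rcases lt_or_ge m d with hm | hm
    · exact hrep _ ((hP.rowDegLT m i).mono hm)
    · change rowForm l T (B (P m i)) u = rowForm l T (P m i) g
      rw [ho m i g (hg.mono hm), hB, map_sum, LinearMap.sum_apply, Finset.sum_eq_zero]
      intro k _
      rw [map_smul, LinearMap.smul_apply, ho m k u (hd.mono hm), smul_zero]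
  rw [LinearMap.mem_ker, LinearMap.sub_apply, sub_eq_zero] at hmem
  exact hmem

end Orthogonal

/-! ### Differential operators acting on rows -/

/-- Entrywise derivative. -/
def derivRow : PolyRow N →ₗ[ℂ] PolyRow N :=
  LinearMap.pi fun i => derivative ∘ₗ LinearMap.proj i

lemma derivRow_apply (v : PolyRow N) (i : Fin N) : derivRow v i = derivative (v i) := rfl

lemma derivRow_pow_apply (k : ℕ) (v : PolyRow N) (i : Fin N) :
    (derivRow ^ k) v i = derivative^[k] (v i) := by
  induction k generalizing v with
  | zero => rfl
  | succ k ih => rw [pow_succ, Module.End.mul_apply, ih]; rfl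

lemma derivRow_vecMul (v : PolyRow N) (F : MatPoly N) :
    derivRow (Matrix.vecMul v F) =
      Matrix.vecMul (derivRow v) F + Matrix.vecMul v (F.map derivative) := by
  ext1 j
  simp [derivRow_apply, Matrix.vecMul, dotProduct, derivative_mul, Finset.sum_add_distrib]

lemma act_add (P : MatPoly N) (D E : DiffOp N) : act P (D + E) = act P D + act P E :=
  Finsupp.sum_add_index' (fun _ => by simp) fun _ _ _ => by rw [mul_add]

lemma act_single (P : MatPoly N) (k : ℕ) (F : MatPoly N) :
    act P (Finsupp.single k F) = P.map (fun p => derivative^[k] p) * F :=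
  Finsupp.sum_single_index (by simp)

/-! ### The factor `1 + X M` -/

/-- The matrix polynomial `1 + X M`. -/
def linFactor (M : Matrix (Fin N) (Fin N) ℂ) : MatPoly N := 1 + (X : ℂ[X]) • constPoly M

/-- The nonzero entries lie in even rows and odd columns. -/
def IsZigzag (M : Matrix (Fin N) (Fin N) ℂ) : Prop :=
  ∀ i j, M i j ≠ 0 → Even (i : ℕ) ∧ ¬ Even (j : ℕ)

lemma constPoly_apply (M : Matrix (Fin N) (Fin N) ℂ) (i j : Fin N) :
    constPoly M i j = C (M i j) := rfl

lemma constPoly_neg (M : Matrix (Fin N) (Fin N) ℂ) : constPoly (-M) = -constPoly M := by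
  ext1 i j; simp [constPoly_apply]

lemma linFactor_apply (M : Matrix (Fin N) (Fin N) ℂ) (i j : Fin N) :
    linFactor M i j = (1 : MatPoly N) i j + X * C (M i j) := rfl

/-- An odd column index is never an even row index, so no two nonzero entries of `M` can be chained,
with or without a diagonal factor between them. -/
lemma IsZigzag.mul_diagonal_mul {M : Matrix (Fin N) (Fin N) ℂ} (hM : IsZigzag M)
    (d : Fin N → ℂ[X]) : constPoly M * Matrix.diagonal d * constPoly M = 0 := by
  ext1 i k
  rw [Matrix.mul_apply]
  refine Finset.sum_eq_zero fun j _ => ?_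
  rw [Matrix.mul_diagonal, constPoly_apply, constPoly_apply]
  by_cases h1 : M i j = 0
  · simp [h1]
  · by_cases h2 : M j k = 0
    · simp [h2]
    · exact absurd (hM j k h2).1 (hM i j h1).2

lemma IsZigzag.mul_self {M : Matrix (Fin N) (Fin N) ℂ} (hM : IsZigzag M) :
    constPoly M * constPoly M = 0 := by
  simpa using hM.mul_diagonal_mul (fun _ => 1)

lemma IsZigzag.linFactor_mul {M : Matrix (Fin N) (Fin N) ℂ} (hM : IsZigzag M) :
    linFactor M * linFactor (-M) = 1 := by
  rw [linFactor, linFactor, constPoly_neg, add_mul, one_mul, mul_add, mul_one, smul_mul_smul_comm,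
    mul_neg, hM.mul_self]
  simp

lemma linFactor_map_conj {M : Matrix (Fin N) (Fin N) ℂ}
    (hM : ∀ i j, starRingEnd ℂ (M i j) = M i j) : (linFactor M).map conjPoly = linFactor M := by
  ext1 i j
  simp only [Matrix.map_apply, linFactor_apply, map_add, map_mul, conjPoly_X, conjPoly_C, hM,
    Matrix.one_apply]
  split_ifs <;> simp

lemma linFactor_map_derivative (M : Matrix (Fin N) (Fin N) ℂ) :
    (linFactor M).map derivative = constPoly M := by
  ext1 i j
  simp only [Matrix.map_apply, linFactor_apply, Matrix.one_apply, constPoly_apply, derivative_add,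
    derivative_mul, derivative_X, derivative_C]
  split_ifs <;> simp

lemma constPoly_map_derivative (M : Matrix (Fin N) (Fin N) ℂ) :
    (constPoly M).map derivative = 0 := by
  ext1 i j
  simp [constPoly_apply]

/-! ### The operator of order two -/

/-- Right multiplication of rows by a matrix polynomial. -/
def mulRight (F : MatPoly N) : PolyRow N →ₗ[ℂ] PolyRow N :=
  (Matrix.vecMulLinear F).restrictScalars ℂ

lemma mulRight_apply (F : MatPoly N) (v : PolyRow N) : mulRight F v = Matrix.vecMul v F := rfl

lemma degree_mul_iterate_derivative_lt {n k : ℕ} {p f : ℂ[X]} (hp : p.degree < n)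
    (hf : f.natDegree ≤ k) : (derivative^[k] p * f).degree < n := by
  rw [degree_lt_iff_coeff_zero] at hp ⊢
  intro m hm
  rw [coeff_mul]
  refine Finset.sum_eq_zero fun x hx => ?_
  have hx' := Finset.HasAntidiagonal.mem_antidiagonal.1 hx
  rcases lt_or_ge k x.2 with h | h
  · rw [coeff_eq_zero_of_natDegree_lt (hf.trans_lt h), mul_zero]
  · rw [coeff_iterate_derivative, hp _ (by omega), smul_zero, zero_mul]

lemma rowDegLT_mulRight {n k : ℕ} {v : PolyRow N} (hv : RowDegLT n v) {F : MatPoly N}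
    (hF : ∀ i j, (F i j).natDegree ≤ k) : RowDegLT n (mulRight F ((derivRow ^ k) v)) := by
  intro j
  rw [← mem_degreeLT]
  change ∑ i, (derivRow ^ k) v i * F i j ∈ degreeLT ℂ n
  refine (degreeLT ℂ n).sum_mem fun i _ => ?_
  rw [mem_degreeLT, derivRow_pow_apply]
  exact degree_mul_iterate_derivative_lt (hv i) (hF i j)

/-- The coefficients of the conjugate by `1 + X M` of the diagonal operator with entries
`∂² σ + ∂ τⱼ + cⱼ`. -/
def bochnerCoeff (M : Matrix (Fin N) (Fin N) ℂ) (σ : ℂ[X]) (τ c : Fin N → ℂ[X]) : ℕ → MatPoly N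
  -- With `T = 1 + XM`, `(vT)'' = v''T + 2v'M` and `(vT)' = v'T + vM`. After multiplication by
  -- `T⁻¹`, the zigzag relations leave `M T⁻¹ = M`, `M τ T⁻¹ = M τ` and `T τ T⁻¹ = τ + X(Mτ - τM)`;
  -- likewise for `c`.
  | 0 => constPoly M * Matrix.diagonal τ + Matrix.diagonal c +
      (X : ℂ[X]) • (constPoly M * Matrix.diagonal c - Matrix.diagonal c * constPoly M)
  | 1 => (2 * σ) • constPoly M + Matrix.diagonal τ +
      (X : ℂ[X]) • (constPoly M * Matrix.diagonal τ - Matrix.diagonal τ * constPoly M)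
  | 2 => σ • 1
  | _ => 0

/-- The differential operator with coefficients `bochnerCoeff`. -/
def bochnerOp (M : Matrix (Fin N) (Fin N) ℂ) (σ : ℂ[X]) (τ c : Fin N → ℂ[X]) : DiffOp N :=
  Finsupp.single 0 (bochnerCoeff M σ τ c 0) + Finsupp.single 1 (bochnerCoeff M σ τ c 1) +
    Finsupp.single 2 (bochnerCoeff M σ τ c 2)

/-- The action of `bochnerOp` on rows. -/
def bochnerRow (M : Matrix (Fin N) (Fin N) ℂ) (σ : ℂ[X]) (τ c : Fin N → ℂ[X]) :
    PolyRow N →ₗ[ℂ] PolyRow N :=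
  ∑ k ∈ Finset.range 3, mulRight (bochnerCoeff M σ τ c k) ∘ₗ derivRow ^ k

section Bochner

variable {M : Matrix (Fin N) (Fin N) ℂ} {σ : ℂ[X]} {τ c : Fin N → ℂ[X]}

lemma act_bochnerOp (P : MatPoly N) (i : Fin N) :
    act P (bochnerOp M σ τ c) i = bochnerRow M σ τ c (P i) := by
  have h : ∀ (k : ℕ) (F : MatPoly N),
      (P.map (fun p => derivative^[k] p) * F) i = mulRight F ((derivRow ^ k) (P i)) := by
    intro k F
    ext1 j
    simp only [Matrix.mul_apply, mulRight_apply, Matrix.vecMul, dotProduct, derivRow_pow_apply,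
      Matrix.map_apply]
  rw [bochnerOp, act_add, act_add, act_single, act_single, act_single]
  have e : ∀ A B C : MatPoly N, (A + B + C) i = A i + B i + C i := fun _ _ _ => rfl
  rw [e, h, h, h, bochnerRow]
  simp only [Finset.sum_range_succ, Finset.sum_range_zero, zero_add, LinearMap.add_apply,
    LinearMap.comp_apply]

lemma hasOrder_bochnerOp (hN : 1 ≤ N) (hσ : σ ≠ 0) : HasOrder (bochnerOp M σ τ c) 2 := by
  constructor
  · intro h
    have h1 := congrFun (congrFun h ⟨0, hN⟩) ⟨0, hN⟩
    simp [bochnerOp, bochnerCoeff] at h1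
    exact hσ h1
  · intro k hk
    have h0 : k ≠ 0 := by omega
    have h1 : k ≠ 1 := by omega
    have h2 : k ≠ 2 := by omega
    simp [bochnerOp, h0, h1, h2]

/-- Right multiplication by `1 + X M` turns `bochnerRow` into a diagonal operator. -/
lemma bochnerRow_intertwine (hM : IsZigzag M) (v : PolyRow N) (j : Fin N) :
    Matrix.vecMul (bochnerRow M σ τ c v) (linFactor M) j =
      σ * derivative (derivative (Matrix.vecMul v (linFactor M) j)) +
        τ j * derivative (Matrix.vecMul v (linFactor M) j) +
        c j * Matrix.vecMul v (linFactor M) j := by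
  have h1 : bochnerCoeff M σ τ c 1 * linFactor M =
      (2 * σ) • constPoly M + linFactor M * Matrix.diagonal τ := by
    have e1 := hM.mul_self
    have e2 := hM.mul_diagonal_mul τ
    have e3 : Matrix.diagonal τ * constPoly M * constPoly M = 0 := by rw [mul_assoc, e1, mul_zero]
    simp only [bochnerCoeff, linFactor, add_mul, mul_add, mul_one, one_mul, mul_smul_comm,
      smul_mul_assoc, sub_mul, e1, e2, e3, smul_zero, sub_self, add_zero, smul_sub]
    abel_nf
  have h0 : bochnerCoeff M σ τ c 0 * linFactor M =
      constPoly M * Matrix.diagonal τ + linFactor M * Matrix.diagonal c := by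
    have e1 := hM.mul_self
    have e2 := hM.mul_diagonal_mul τ
    have e4 := hM.mul_diagonal_mul c
    have e3 : Matrix.diagonal c * constPoly M * constPoly M = 0 := by rw [mul_assoc, e1, mul_zero]
    simp only [bochnerCoeff, linFactor, add_mul, mul_add, mul_one, one_mul, mul_smul_comm,
      smul_mul_assoc, sub_mul, e2, e3, e4, smul_zero, sub_self, add_zero, smul_sub]
    abel_nf
  have d1 : derivRow (Matrix.vecMul v (linFactor M)) =
      Matrix.vecMul (derivRow v) (linFactor M) + Matrix.vecMul v (constPoly M) := by
    rw [derivRow_vecMul, linFactor_map_derivative]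
  have d2 : derivRow (derivRow (Matrix.vecMul v (linFactor M))) =
      Matrix.vecMul (derivRow (derivRow v)) (linFactor M) +
        2 • Matrix.vecMul (derivRow v) (constPoly M) := by
    rw [d1, map_add, derivRow_vecMul, derivRow_vecMul, linFactor_map_derivative,
      constPoly_map_derivative, Matrix.vecMul_zero, add_zero, two_smul, add_assoc]
  have key : Matrix.vecMul (bochnerRow M σ τ c v) (linFactor M) =
      σ • derivRow (derivRow (Matrix.vecMul v (linFactor M))) +
      Matrix.vecMul (derivRow (Matrix.vecMul v (linFactor M))) (Matrix.diagonal τ) +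
      Matrix.vecMul (Matrix.vecMul v (linFactor M)) (Matrix.diagonal c) := by
    rw [d2, d1]
    simp only [bochnerRow, Finset.sum_range_succ, Finset.sum_range_zero, zero_add,
      LinearMap.add_apply, LinearMap.comp_apply, mulRight_apply, pow_zero, pow_one, pow_two,
      Module.End.mul_apply, Module.End.one_apply, Matrix.add_vecMul, Matrix.vecMul_vecMul, h0, h1,
      Matrix.vecMul_add, Matrix.vecMul_smul]
    simp only [bochnerCoeff, smul_mul_assoc, one_mul, Matrix.vecMul_smul, smul_add, mul_smul,
      two_smul]
    abel
  rw [key]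
  simp only [Pi.add_apply, Pi.smul_apply, derivRow_apply, Matrix.vecMul_diagonal, smul_eq_mul]
  ring

/-- The Pearson equation turns both sides into `l(c p q - σ p' q')`, which is symmetric in `p` and
`q`. -/
lemma IsPearson.symm {τ : ℂ[X]} {l : ℂ[X] →ₗ[ℂ] ℂ} (hl : IsPearson σ τ l) (c p q : ℂ[X]) :
    l ((σ * derivative (derivative p) + τ * derivative p + c * p) * q) =
      l (p * (σ * derivative (derivative q) + τ * derivative q + c * q)) := by
  have h1 := hl (derivative p * q)
  have h2 := hl (p * derivative q)
  rw [← sub_eq_zero, ← map_sub, ← sub_zero (0 : ℂ)]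
  nth_rewrite 1 [← h1]
  rw [← h2, ← map_sub]
  congr 1
  simp only [derivative_mul]
  ring

lemma bochnerRow_symm {l : Fin N → ℂ[X] →ₗ[ℂ] ℂ} (hM : IsZigzag M)
    (hl : ∀ j, IsPearson σ (τ j) (l j)) (v u : PolyRow N) :
    rowForm l (linFactor M) (bochnerRow M σ τ c v) u =
      rowForm l (linFactor M) v (bochnerRow M σ τ c u) := by
  simp only [rowForm_apply, bochnerRow_intertwine hM, (hl _).symm]

/-- The terms in `X` could raise the degree by one, but only at the nonzero entries of `M`. There
the factor multiplying `M i j` is `τⱼ + X(cⱼ - cᵢ)` in order zero and `2σ + X(τⱼ - τᵢ)` in order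
one, so `h0` and `h1` ask for exactly the needed cancellations. -/
lemma natDegree_bochnerCoeff (hσ : σ.natDegree ≤ 2) (hτ : ∀ j, (τ j).natDegree ≤ 1)
    (hc : ∀ j, (c j).natDegree ≤ 0)
    (h1 : ∀ i j, M i j ≠ 0 → (2 * σ + X * (τ j - τ i)).natDegree ≤ 1)
    (h0 : ∀ i j, M i j ≠ 0 → (τ j + X * (c j - c i)).natDegree ≤ 0) (k : ℕ) (i j : Fin N) :
    (bochnerCoeff M σ τ c k i j).natDegree ≤ k := by
  have hd : ∀ (d : Fin N → ℂ[X]) (m : ℕ), (∀ j, (d j).natDegree ≤ m) →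
      (Matrix.diagonal d i j).natDegree ≤ m := by
    intro d m h
    rw [Matrix.diagonal_apply]
    split_ifs
    · exact h i
    · simp
  have hC : ∀ (q : ℂ[X]) (m : ℕ), (M i j ≠ 0 → q.natDegree ≤ m) →
      (C (M i j) * q).natDegree ≤ m := by
    intro q m h
    by_cases h' : M i j = 0
    · simp [h']
    · exact (natDegree_C_mul_le _ _).trans (h h')
  match k with
  | 0 =>
    have e : bochnerCoeff M σ τ c 0 i j =
        C (M i j) * (τ j + X * (c j - c i)) + Matrix.diagonal c i j := by
      simp only [bochnerCoeff, Matrix.add_apply, Matrix.smul_apply, Matrix.sub_apply,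
        Matrix.mul_diagonal, Matrix.diagonal_mul, constPoly_apply, smul_eq_mul]
      ring
    rw [e]
    exact natDegree_add_le_of_degree_le (hC _ _ (h0 i j)) (hd _ _ hc)
  | 1 =>
    have e : bochnerCoeff M σ τ c 1 i j =
        C (M i j) * (2 * σ + X * (τ j - τ i)) + Matrix.diagonal τ i j := by
      simp only [bochnerCoeff, Matrix.add_apply, Matrix.smul_apply, Matrix.sub_apply,
        Matrix.mul_diagonal, Matrix.diagonal_mul, constPoly_apply, smul_eq_mul]
      ring
    rw [e]
    exact natDegree_add_le_of_degree_le (hC _ _ (h1 i j)) (hd _ _ hτ)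
  | 2 =>
    have e : bochnerCoeff M σ τ c 2 i j = Matrix.diagonal (fun _ => σ) i j := by
      simp [bochnerCoeff, Matrix.diagonal_apply, Matrix.one_apply]
    rw [e]
    exact hd _ _ fun _ => hσ
  | k + 3 => simp [bochnerCoeff]

lemma rowDegLT_bochnerRow (hdeg : ∀ k i j, (bochnerCoeff M σ τ c k i j).natDegree ≤ k) {n : ℕ}
    {v : PolyRow N} (hv : RowDegLT n v) : RowDegLT n (bochnerRow M σ τ c v) := by
  have h : ∀ k, RowDegLT n (mulRight (bochnerCoeff M σ τ c k) ((derivRow ^ k) v)) := fun k =>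
    rowDegLT_mulRight (k := k) (F := bochnerCoeff M σ τ c k) hv (hdeg k)
  rw [bochnerRow, LinearMap.sum_apply]
  exact RowDegLT.sum _ h

end Bochner

/-! ### Passage from integrals to forms, and solution of the Bochner problem -/

/-- A weight is represented by a bilinear form on rows. -/
def IsRepresented (W : ℝ → Matrix (Fin N) (Fin N) ℂ) (l : Fin N → ℂ[X] →ₗ[ℂ] ℂ)
    (T : MatPoly N) : Prop :=
  ∀ P Q i k, innerW W P Q i k = rowForm l T (P i) (conjRow (Q k))

lemma solvesMatrixBochner_of_pearson (hN : 1 ≤ N) {W : ℝ → Matrix (Fin N) (Fin N) ℂ}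
    {l : Fin N → ℂ[X] →ₗ[ℂ] ℂ} {M : Matrix (Fin N) (Fin N) ℂ} {σ : ℂ[X]} {τ c : Fin N → ℂ[X]}
    (hW : IsRepresented W l (linFactor M)) (hM : IsZigzag M)
    (h : IsFactored l (linFactor M) (linFactor (-M))) (hl : ∀ j, IsPearson σ (τ j) (l j))
    (hσ0 : σ ≠ 0) (hdeg : ∀ k i j, (bochnerCoeff M σ τ c k i j).natDegree ≤ k) :
    SolvesMatrixBochner W := by
  obtain ⟨P, hP, ho⟩ := h.exists_monicSeq
  refine ⟨bochnerOp M σ τ c, ⟨P, ⟨hP.1, fun n => ?_, fun n m hnm => ?_⟩, fun n => ?_⟩,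
    hasOrder_bochnerOp hN hσ0⟩
  · rw [hP.2]; exact isUnit_one
  · ext i k
    rw [hW]
    exact ho.pairwise h hP hnm i k
  · refine ⟨Matrix.of fun i k => (bochnerRow M σ τ c (P n i) k).coeff n, ?_⟩
    ext1 i j
    rw [act_bochnerOp, ho.eigen h hP (bochnerRow_symm hM hl)
      (fun n v hv => rowDegLT_bochnerRow hdeg hv) n i, Finset.sum_apply, Matrix.mul_apply]
    refine Finset.sum_congr rfl fun k _ => ?_
    rw [Pi.smul_apply, smul_eq_C_mul]; rfl

/-! ### Operators having the orthogonal polynomials as eigenfunctions -/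

/-- Rows with a single nonzero entry. -/
def singleRow (i : Fin N) : ℂ[X] →ₗ[ℂ] PolyRow N := LinearMap.single ℂ (fun _ => ℂ[X]) i

lemma singleRow_same (i : Fin N) (p : ℂ[X]) : singleRow i p i = p := Pi.single_eq_same (M := fun _ => ℂ[X]) i p

lemma singleRow_of_ne {i j : Fin N} (h : j ≠ i) (p : ℂ[X]) : singleRow i p j = 0 :=
  Pi.single_eq_of_ne (M := fun _ => ℂ[X]) h p

lemma singleRow_vecMul (i : Fin N) (p : ℂ[X]) (F : MatPoly N) (j : Fin N) :
    Matrix.vecMul (singleRow i p) F j = p * F i j := by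
  change ∑ k, singleRow i p k * F k j = _
  rw [Finset.sum_eq_single i (fun k _ hk => by rw [singleRow_of_ne hk, zero_mul])
    (fun h => absurd (Finset.mem_univ i) h), singleRow_same]

lemma singleRow_X_pow_rowDegLT (i : Fin N) (n : ℕ) :
    RowDegLT (n + 1) (singleRow i (X ^ n : ℂ[X])) := by
  rw [rowDegLT_iff]
  intro j m hm
  by_cases hj : j = i
  · subst hj; rw [singleRow_same, coeff_X_pow, if_neg (by omega)]
  · rw [singleRow_of_ne hj, coeff_zero]

/-- The diagonal coefficient of a differential operator is polynomial in the degree. -/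
lemma IsDiff.exists_symbol {E : ℂ[X] →ₗ[ℂ] ℂ[X]} (h : IsDiff E) :
    ∃ Q : ℂ[X], ∀ n : ℕ, (E (X ^ n)).coeff n = Q.eval (n : ℂ) := by
  obtain ⟨m, f, hf⟩ := h.exists_coeffs
  refine ⟨∑ k ∈ Finset.range m, C ((f k).coeff k) * descPochhammer ℂ k, fun n => ?_⟩
  rw [hf, finsetSum_coeff, eval_finsetSum]
  refine Finset.sum_congr rfl fun k _ => ?_
  rw [eval_mul, eval_C, descPochhammer_eval_eq_descFactorial, iterate_derivative_X_pow_eq_natCast_mul]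
  rw [mul_left_comm, ← C_eq_natCast, coeff_C_mul]
  -- Only the coefficient of `x^k` in `f k` reaches `xⁿ`, with falling factorial weight; for `k > n`
  -- both sides vanish.
  rcases le_or_gt k n with hk | hk
  · have : (f k * X ^ (n - k)).coeff (k + (n - k)) = (f k).coeff k := coeff_mul_X_pow _ _ _
    rw [Nat.add_sub_cancel' hk] at this
    rw [this, mul_comm]
  · rw [Nat.descFactorial_of_lt hk]; simp

/-- Conjugation by an invertible matrix polynomial. -/
def conjugate (T T' : MatPoly N) (B : PolyRow N →ₗ[ℂ] PolyRow N) : PolyRow N →ₗ[ℂ] PolyRow N :=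
  mulRight T ∘ₗ B ∘ₗ mulRight T'

/-- The entries of an endomorphism of rows. -/
def entry (E : PolyRow N →ₗ[ℂ] PolyRow N) (i j : Fin N) : ℂ[X] →ₗ[ℂ] ℂ[X] :=
  LinearMap.proj j ∘ₗ E ∘ₗ singleRow i

lemma isDiff_mulRight (F : MatPoly N) : IsDiff (mulRight F) :=
  .of_comm fun v => (Matrix.vecMulLinear F).map_smul _ v

lemma IsDiff.entry {E : PolyRow N →ₗ[ℂ] PolyRow N} (h : IsDiff E) (i j : Fin N) :
    IsDiff (entry E i j) :=
  IsDiff.comp (.of_comm fun _ => rfl) (h.comp (.of_comm fun p =>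
    (LinearMap.single ℂ[X] (fun _ => ℂ[X]) i).map_smul X p))

section Core

variable {l : Fin N → ℂ[X] →ₗ[ℂ] ℂ} {T T' : MatPoly N}

/-- Testing the adjoint on rows `p eᵢ T⁻¹` and `q eⱼ T⁻¹` undoes the factor `T`, so that a single
coordinate survives on each side: `j` on the left and `i` on the right. -/
lemma entry_conjugate_adjointable (h : IsFactored l T T') {B : PolyRow N →ₗ[ℂ] PolyRow N}
    (hB : ∀ u, ∃ g, ∀ v, rowForm l T (B v) u = rowForm l T v g) (i j : Fin N) (q : ℂ[X]) :
    ∃ g, ∀ p, l j (entry (conjugate T T' B) i j p * q) = l i (p * g) := by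
  obtain ⟨g, hg⟩ := hB (Matrix.vecMul (singleRow j q) T')
  refine ⟨Matrix.vecMul g T i, fun p => ?_⟩
  have h1 := hg (Matrix.vecMul (singleRow i p) T')
  rw [rowForm_apply, rowForm_apply, Matrix.vecMul_vecMul, Matrix.vecMul_vecMul, h.inv_mul,
    Matrix.vecMul_one, Matrix.vecMul_one] at h1
  rw [Finset.sum_eq_single j (fun k _ hk => by rw [singleRow_of_ne hk, mul_zero, map_zero])
    (fun h => absurd (Finset.mem_univ j) h), Finset.sum_eq_single i
    (fun k _ hk => by rw [singleRow_of_ne hk, zero_mul, map_zero])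
    (fun h => absurd (Finset.mem_univ i) h), singleRow_same, singleRow_same] at h1
  exact h1

lemma conjugate_singleRow_of_diagonal {E : PolyRow N →ₗ[ℂ] PolyRow N}
    (hE : ∀ i j, i ≠ j → entry E i j = 0) (i : Fin N) (p : ℂ[X]) :
    E (singleRow i p) = singleRow i (entry E i i p) := by
  ext1 j
  by_cases hj : j = i
  · subst hj; rw [singleRow_same]; rfl
  · rw [singleRow_of_ne hj]; exact LinearMap.congr_fun (hE i j (Ne.symm hj)) p

lemma eq_conjugate (h : IsFactored l T T') (B : PolyRow N →ₗ[ℂ] PolyRow N) (v : PolyRow N) :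
    B v = Matrix.vecMul (conjugate T T' B (Matrix.vecMul v T)) T' := by
  change _ = Matrix.vecMul (Matrix.vecMul (B (Matrix.vecMul (Matrix.vecMul v T) T')) T) T'
  rw [Matrix.vecMul_vecMul, Matrix.vecMul_vecMul, h.mul_inv, Matrix.vecMul_one, Matrix.vecMul_one]

/-- Functionals between which no nonzero differential operator is adjointable. -/
def AreIndependent (l : Fin N → ℂ[X] →ₗ[ℂ] ℂ) : Prop :=
  ∀ i j, i ≠ j → ∀ E : ℂ[X] →ₗ[ℂ] ℂ[X], IsDiff E →
    (∀ q, ∃ g, ∀ p, l j (E p * q) = l i (p * g)) → E = 0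

/-- Eigenvalues of the differential operators of `T diag(w) T^*`, restricted to two rows linked by
the linear factor. -/
lemma exists_eigenvalue_symbol {M : Matrix (Fin N) (Fin N) ℂ}
    (h : IsFactored l (linFactor M) (linFactor (-M))) (hind : AreIndependent l)
    {i₀ i₁ : Fin N} (hi : i₀ ≠ i₁) {a : ℂ} (ha : a ≠ 0)
    (hM0 : ∀ k, M i₀ k = if k = i₁ then a else 0) (hM1 : ∀ k, M i₁ k = 0)
    {P : ℕ → MatPoly N} (hP : IsMonicSeq P) (ho : IsRowOrthogonal l (linFactor M) P)
    {B : PolyRow N →ₗ[ℂ] PolyRow N} (hBd : IsDiff B) {L : ℕ → Matrix (Fin N) (Fin N) ℂ}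
    (hB : ∀ n i, B (P n i) = ∑ k, L n i k • P n k) :
    ∃ Q : ℂ[X], ∀ n : ℕ, L n i₁ i₁ = Q.eval (n : ℂ) ∧ L n i₀ i₀ = Q.eval ((n : ℂ) + 1) ∧
      ∀ k, k ≠ i₁ → L n i₁ k = 0 := by
  set E := conjugate (linFactor M) (linFactor (-M)) B with hEdef
  have hEd : IsDiff E := (isDiff_mulRight _).comp (hBd.comp (isDiff_mulRight _))
  have hdiag : ∀ i j, i ≠ j → entry E i j = 0 := fun i j hij =>
    hind i j hij _ (hEd.entry i j)
      (entry_conjugate_adjointable h (ho.exists_adjoint h hP hB) i j)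
  have hEs := conjugate_singleRow_of_diagonal hdiag
  have hT0 : ∀ p, Matrix.vecMul (singleRow i₀ p) (linFactor M) =
      singleRow i₀ p + singleRow i₁ (a • (X * p)) := by
    intro p
    ext1 j
    rw [singleRow_vecMul, linFactor_apply, hM0, Pi.add_apply]
    by_cases h0 : j = i₀
    · subst h0
      rw [singleRow_same, singleRow_of_ne hi, if_neg hi, Matrix.one_apply_eq]; simp
    · rw [singleRow_of_ne h0, Matrix.one_apply_ne (Ne.symm h0)]
      by_cases h1 : j = i₁
      · subst h1; rw [singleRow_same, if_pos rfl, smul_eq_C_mul]; ring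
      · rw [singleRow_of_ne h1, if_neg h1]; simp
  -- The scalar `c` covers both `T` (`c = 1`) and its inverse (`c = -1`).
  have hT1 : ∀ (c : ℂ) p, Matrix.vecMul (singleRow i₁ p) (linFactor (c • M)) = singleRow i₁ p := by
    intro c p
    ext1 j
    rw [singleRow_vecMul, linFactor_apply, Matrix.smul_apply, hM1, smul_zero, C_0, mul_zero,
      add_zero, Matrix.one_apply]
    split_ifs with hj
    · subst hj; rw [singleRow_same, mul_one]
    · rw [singleRow_of_ne (Ne.symm hj), mul_zero]
  have hT0' : ∀ p, Matrix.vecMul (singleRow i₀ p) (linFactor (-M)) i₀ = p ∧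
      Matrix.vecMul (singleRow i₀ p) (linFactor (-M)) i₁ = -(a • (X * p)) := by
    intro p
    rw [singleRow_vecMul, singleRow_vecMul, linFactor_apply, linFactor_apply, Matrix.neg_apply,
      Matrix.neg_apply, hM0, hM0, if_neg hi, if_pos rfl, Matrix.one_apply_eq,
      Matrix.one_apply_ne hi, smul_eq_C_mul]
    constructor
    · simp
    · rw [map_neg C a]; ring
  have hTm := hT1 (-1)
  have hTp := hT1 1
  rw [neg_one_smul] at hTm
  rw [one_smul] at hTp
  have hB1 : ∀ p, B (singleRow i₁ p) = singleRow i₁ (entry E i₁ i₁ p) := by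
    intro p
    rw [eq_conjugate h B, ← hEdef, hTp, hEs, hTm]
  have hB0 : ∀ p, B (singleRow i₀ p) =
      Matrix.vecMul (singleRow i₀ (entry E i₀ i₀ p)) (linFactor (-M)) +
        singleRow i₁ (a • entry E i₁ i₁ (X * p)) := by
    intro p
    rw [eq_conjugate h B, ← hEdef, hT0, map_add, hEs, hEs, Matrix.add_vecMul, hTm, map_smul]
  have hL : ∀ n i k, L n i k = (B (singleRow i (X ^ n)) k).coeff n := by
    intro n i k
    rw [hP.eigen_coeff hB n (singleRow_X_pow_rowDegLT i n), Finset.sum_eq_single i]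
    · rw [singleRow_same, coeff_X_pow_self, one_mul]
    · intro j _ hj; rw [singleRow_of_ne hj, coeff_zero, zero_mul]
    · intro hni; exact absurd (Finset.mem_univ i) hni
  obtain ⟨Q, hQ⟩ := (hEd.entry i₁ i₁).exists_symbol
  refine ⟨Q, fun n => ⟨?_, ?_, fun k hk => ?_⟩⟩
  · rw [hL, hB1, singleRow_same, hQ]
  -- Coordinate `i₁` of `B(xⁿ e_{i₀})` is `a(E₁₁(xⁿ⁺¹) - x E₀₀(xⁿ))`. It has degree at most `n`, so
  -- its coefficient at `n + 1` vanishes: the diagonal symbol of `E₀₀` at `n` is that of `E₁₁` at `n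
  -- + 1`.
  · have hdeg := (hP.eigen_rowDegLT hB (singleRow_X_pow_rowDegLT i₀ n)).coeff le_rfl i₁
    rw [hB0, Pi.add_apply, (hT0' _).2, singleRow_same, ← pow_succ', ← smul_neg, ← smul_add,
      coeff_smul, smul_eq_mul, mul_eq_zero, or_iff_right ha, coeff_add, coeff_neg, coeff_X_mul,
      hQ, neg_add_eq_zero] at hdeg
    rw [hL, hB0, Pi.add_apply, (hT0' _).1, singleRow_of_ne hi, add_zero, hdeg]
    push_cast; rfl
  · rw [hL, hB1, singleRow_of_ne hk, coeff_zero]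

end Core

/-! ### The contradiction from rank one and shifted symbols -/

lemma eq_zero_of_eval_mul_eval_add_one {Q : ℂ[X]}
    (h : ∀ᶠ n : ℕ in Filter.atTop, Q.eval (n : ℂ) * Q.eval ((n : ℂ) + 1) = 0) : Q = 0 := by
  have h0 : Q * Q.comp (X + C 1) = 0 := by
    refine eq_zero_of_infinite_isRoot _ ?_
    obtain ⟨n₀, hn₀⟩ := Filter.eventually_atTop.1 h
    refine Set.Infinite.mono (s := (fun n : ℕ => (n : ℂ)) '' Set.Ici n₀) ?_
      ((Set.Ici_infinite n₀).image Nat.cast_injective.injOn)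
    rintro _ ⟨n, hn, rfl⟩
    change IsRoot _ _
    simpa [IsRoot] using hn₀ n hn
  rcases mul_eq_zero.1 h0 with h | h
  · exact h
  · exact comp_X_add_C_eq_zero_iff.1 h

/-- The matrices `C' eₛ C`, with `C`, `C'` eventually invertible, cannot all be eigenvalues of the
form described in `exists_eigenvalue_symbol`. -/
lemma not_all_symbols {i₀ i₁ : Fin N} (hi : i₀ ≠ i₁) {C C' : ℕ → Matrix (Fin N) (Fin N) ℂ}
    (hC : ∀ᶠ n in Filter.atTop, IsUnit (C n)) (hC' : ∀ᶠ n in Filter.atTop, IsUnit (C' n))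
    (h : ∀ s, ∃ Q : ℂ[X], ∀ n : ℕ, C' n i₁ s * C n s i₁ = Q.eval (n : ℂ) ∧
      C' n i₀ s * C n s i₀ = Q.eval ((n : ℂ) + 1) ∧
      ∀ k, k ≠ i₁ → C' n i₁ s * C n s k = 0) : False := by
  have hzero : ∀ s n k, C' n i₁ s * C n s k = 0 := by
    intro s n k
    obtain ⟨Q, hQ⟩ := h s
    have hQ0 : Q = 0 := by
      refine eq_zero_of_eval_mul_eval_add_one (Filter.Eventually.of_forall fun n => ?_)
      rw [← (hQ n).1, ← (hQ n).2.1]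
      -- The vanishing 2×2 minor on `i₀, i₁` of a rank-one matrix: the product of diagonal entries
      -- equals the product of the off-diagonal ones, one of which is zero.
      linear_combination (C n s i₁ * C' n i₀ s) * (hQ n).2.2 i₀ hi
    by_cases hk : k = i₁
    · rw [hk, (hQ n).1, hQ0, eval_zero]
    · exact (hQ n).2.2 k hk
  obtain ⟨n, hn, hn'⟩ := (hC.and hC').exists
  have hu : IsUnit (C' n * C n).det := (Matrix.isUnit_iff_isUnit_det _).1 (hn'.mul hn)
  refine hu.ne_zero (Matrix.det_eq_zero_of_row_eq_zero i₁ fun k => ?_)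
  rw [Matrix.mul_apply]
  exact Finset.sum_eq_zero fun s _ => hzero s n k

/-! ### Rational rows -/

/-- Row vectors of rational functions. -/
abbrev RatRow (N : ℕ) : Type := Fin N → RatFunc ℂ

/-- Polynomial rows as rational rows. -/
def rowToRat : PolyRow N →ₗ[ℂ] RatRow N :=
  LinearMap.pi fun i => (Algebra.linearMap ℂ[X] (RatFunc ℂ)).restrictScalars ℂ ∘ₗ LinearMap.proj i

lemma rowToRat_apply (v : PolyRow N) (i : Fin N) :
    rowToRat v i = algebraMap ℂ[X] (RatFunc ℂ) (v i) := rfl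

lemma rowToRat_eq (P : MatPoly N) (i : Fin N) : rowToRat (P i) = toRat P i := rfl

lemma rowToRat_injective : Function.Injective (rowToRat : PolyRow N →ₗ[ℂ] RatRow N) := by
  intro u v h
  ext1 i
  exact RatFunc.algebraMap_injective ℂ (congrFun h i)

lemma rowToRat_X_smul (v : PolyRow N) :
    rowToRat ((X : ℂ[X]) • v) = (X : ℂ[X]) • rowToRat v := by
  ext1 i
  rw [rowToRat_apply, Pi.smul_apply, Pi.smul_apply, rowToRat_apply, smul_eq_mul, map_mul,
    Algebra.smul_def]

/-- Right multiplication of rational rows. -/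
def ratMulRight (F : MatRat N) : RatRow N →ₗ[ℂ] RatRow N :=
  (Matrix.vecMulLinear F).restrictScalars ℂ

lemma ratMulRight_apply (F : MatRat N) (v : RatRow N) : ratMulRight F v = Matrix.vecMul v F := rfl

lemma isDiff_ratMulRight (F : MatRat N) : IsDiff (ratMulRight F) := by
  refine .of_comm fun v => ?_
  have h : ∀ u : RatRow N, (X : ℂ[X]) • u = algebraMap ℂ[X] (RatFunc ℂ) X • u := fun u => by
    ext1 i; rw [Pi.smul_apply, Pi.smul_apply, Algebra.smul_def, smul_eq_mul]
  rw [h, h]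
  exact (Matrix.vecMulLinear F).map_smul _ v

/-- Entrywise derivative of rational rows. -/
def ratDerivRow : RatRow N →ₗ[ℂ] RatRow N :=
  LinearMap.pi fun i => ratDerivL ∘ₗ LinearMap.proj i

lemma ratDerivRow_pow_apply (k : ℕ) (v : RatRow N) (i : Fin N) :
    (ratDerivRow ^ k) v i = ratDeriv^[k] (v i) := by
  induction k generalizing v with
  | zero => rfl
  | succ k ih => rw [pow_succ, Module.End.mul_apply, ih]; rfl

lemma isDiff_ratDerivRow : IsDiff (ratDerivRow (N := N)) := by
  refine .of_deriv fun v => ?_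
  ext1 i
  change ratDeriv ((X : ℂ[X]) • v i) = v i + (X : ℂ[X]) • ratDeriv (v i)
  rw [Algebra.smul_def, ratDeriv_mul, ratDeriv_algebraMap, Algebra.smul_def]
  simp

/-- The action of a differential operator on rational rows. -/
def ratAct (D : DiffOp N) : RatRow N →ₗ[ℂ] RatRow N :=
  ∑ k ∈ D.support, ratMulRight (toRat (D k)) ∘ₗ ratDerivRow ^ k

lemma isDiff_ratAct (D : DiffOp N) : IsDiff (ratAct D) :=
  IsDiff.sum _ _ fun _ => (isDiff_ratMulRight _).comp (isDiff_ratDerivRow.pow _)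

lemma actRat_row (P : MatRat N) (D : DiffOp N) (i : Fin N) : actRat P D i = ratAct D (P i) := by
  ext1 j
  rw [ratAct, LinearMap.sum_apply, Finset.sum_apply, actRat, Finsupp.sum, Matrix.sum_apply]
  refine Finset.sum_congr rfl fun k _ => ?_
  simp only [LinearMap.comp_apply, ratMulRight_apply, Matrix.mul_apply, Matrix.vecMul, dotProduct,
    ratDerivRow_pow_apply, Matrix.map_apply]

lemma toRat_act (P : MatPoly N) (D : DiffOp N) : toRat (act P D) = actRat (toRat P) D := by
  ext1 i j
  rw [actRat, Finsupp.sum, Matrix.sum_apply, toRat, Matrix.map_apply, act, Finsupp.sum,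
    Matrix.sum_apply, map_sum]
  refine Finset.sum_congr rfl fun k _ => ?_
  rw [Matrix.mul_apply, Matrix.mul_apply, map_sum]
  refine Finset.sum_congr rfl fun m _ => ?_
  rw [map_mul]
  simp only [toRat, Matrix.map_apply, ratDeriv_iterate_algebraMap]

lemma constPoly_mul_row (K : Matrix (Fin N) (Fin N) ℂ) (P : MatPoly N) (i : Fin N) :
    (constPoly K * P) i = ∑ k, K i k • P k := by
  ext1 j
  rw [Matrix.mul_apply, Finset.sum_apply]
  exact Finset.sum_congr rfl fun k _ => (smul_eq_C_mul _).symm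

/-! ### Eigen-operators produced by a Darboux transformation of a direct sum -/

/-- A Darboux transformation of diagonal polynomials gives, for each diagonal position, a
differential operator acting on the transformed polynomials by a matrix of rank at most one. -/
lemma exists_rankOne_operators {P P' : ℕ → MatPoly N} (hP' : IsMonicSeq P')
    (hdiag : ∀ n i j, i ≠ j → P n i j = 0) {D D' : DiffOp N} {F F' : MatPoly N}
    {C C' : ℕ → Matrix (Fin N) (Fin N) ℂ}
    (h : ∀ n, toRat (constPoly (C n) * P' n) = toRat (act (P n) D) * (toRat F)⁻¹)
    (h' : ∀ n, toRat (constPoly (C' n) * P n) = actRat (toRat (P' n) * (toRat F')⁻¹) D')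
    (s : Fin N) :
    ∃ B : PolyRow N →ₗ[ℂ] PolyRow N, IsDiff B ∧
      ∀ n i, B (P' n i) = ∑ k, (C' n i s * C n s k) • P' n k := by
  let L₁ : RatRow N →ₗ[ℂ] RatRow N := ratMulRight (toRat F)⁻¹ ∘ₗ ratAct D
  let L₂ : RatRow N →ₗ[ℂ] RatRow N := ratAct D' ∘ₗ ratMulRight (toRat F')⁻¹
  let e : RatRow N →ₗ[ℂ] RatRow N := ratMulRight (Matrix.single s s 1)
  let L : RatRow N →ₗ[ℂ] RatRow N := L₁ ∘ₗ e ∘ₗ L₂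
  have hLd : IsDiff L := ((isDiff_ratMulRight _).comp (isDiff_ratAct D)).comp
    ((isDiff_ratMulRight _).comp ((isDiff_ratAct D').comp (isDiff_ratMulRight _)))
  have h1 : ∀ n i, L₁ (rowToRat (P n i)) = ∑ k, C n i k • rowToRat (P' n k) := by
    intro n i
    have := congrFun (h n) i
    rw [toRat_act, ← rowToRat_eq, constPoly_mul_row, map_sum] at this
    simp only [map_smul] at this
    rw [this]
    change Matrix.vecMul (ratAct D (toRat (P n) i)) _ = _
    rw [← actRat_row]; rfl
  have h2 : ∀ n i, L₂ (rowToRat (P' n i)) = ∑ k, C' n i k • rowToRat (P n k) := by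
    intro n i
    have := congrFun (h' n) i
    rw [← rowToRat_eq, constPoly_mul_row, map_sum, actRat_row] at this
    simp only [map_smul] at this
    rw [this]; rfl
  -- This is where the direct sum matters: row `k` of a diagonal `P n` is supported at `k`, so the
  -- coordinate projection either keeps or kills it.
  have he : ∀ n k, e (rowToRat (P n k)) = if k = s then rowToRat (P n k) else 0 := by
    intro n k
    ext1 j
    change Matrix.vecMul (rowToRat (P n k)) (Matrix.single s s 1) j = _
    rw [Matrix.vecMul, dotProduct, Finset.sum_eq_single s]
    · rw [rowToRat_apply]
      by_cases hks : k = s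
      · subst hks
        rw [if_pos rfl, rowToRat_apply]
        by_cases hj : k = j
        · subst hj; simp
        · rw [hdiag n k j hj, Matrix.single_apply_of_ne _ _ _ _ _ (by tauto)]; simp
      · rw [hdiag n k s hks, if_neg hks]; simp
    · intro m _ hm
      rw [Matrix.single_apply_of_ne _ _ _ _ _ (by tauto), mul_zero]
    · intro hs; exact absurd (Finset.mem_univ s) hs
  have hL : ∀ n i, L (rowToRat (P' n i)) =
      rowToRat (∑ k, (C' n i s * C n s k) • P' n k) := by
    intro n i
    change L₁ (e (L₂ (rowToRat (P' n i)))) = _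
    rw [h2, map_sum]
    simp only [map_smul, he, smul_ite, smul_zero]
    rw [Finset.sum_ite_eq' Finset.univ s, if_pos (Finset.mem_univ s), map_smul, h1, map_sum,
      Finset.smul_sum]
    simp only [map_smul, smul_smul]
  -- A priori `L` has rational coefficients. It sends rows of each `P' n` to polynomial rows, and
  -- these span, so it restricts to polynomial rows.
  have hrange : ∀ v : PolyRow N, (L ∘ₗ rowToRat) v ∈ LinearMap.range (rowToRat (N := N)) := by
    intro v
    obtain ⟨n, hn⟩ := exists_rowDegLT v
    refine hP'.mem_of_rowDegLT ((LinearMap.range (rowToRat (N := N))).comap (L ∘ₗ rowToRat))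
      (fun m _ i => ?_) hn
    exact ⟨_, (hL m i).symm⟩
  let B : PolyRow N →ₗ[ℂ] PolyRow N :=
    (LinearEquiv.ofInjective rowToRat rowToRat_injective).symm.toLinearMap ∘ₗ
      (L ∘ₗ rowToRat).codRestrict _ hrange
  have hB : ∀ v, rowToRat (B v) = L (rowToRat v) := by
    intro v
    have := LinearEquiv.apply_symm_apply
      (LinearEquiv.ofInjective (rowToRat (N := N)) rowToRat_injective) ⟨_, hrange v⟩
    exact congrArg Subtype.val this
  refine ⟨B, hLd.of_intertwine rowToRat_injective rowToRat_X_smul hB, fun n i => ?_⟩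
  apply rowToRat_injective
  rw [hB, hL]

/-! ### The moment functional of a weight -/

/-- All moments are finite. -/
def HasMoments (w : ℝ → ℝ) : Prop := ∀ n : ℕ, Integrable fun x : ℝ => (x : ℂ) ^ n * (w x : ℂ)

lemma HasMoments.integrable {w : ℝ → ℝ} (hw : HasMoments w) (p : ℂ[X]) :
    Integrable fun x : ℝ => p.eval (x : ℂ) * (w x : ℂ) := by
  induction p using Polynomial.induction_on' with
  | add p q hp hq => simp only [eval_add, add_mul]; exact hp.add hq
  | monomial n c =>
    simpa only [eval_monomial, mul_assoc] using (hw n).const_mul c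

/-- The moment functional `p ↦ ∫ p w`. -/
def moment (w : ℝ → ℝ) (hw : HasMoments w) : ℂ[X] →ₗ[ℂ] ℂ where
  toFun p := ∫ x : ℝ, p.eval (x : ℂ) * (w x : ℂ)
  map_add' p q := by
    simp only [eval_add, add_mul]
    exact integral_add (hw.integrable p) (hw.integrable q)
  map_smul' c p := by
    simp only [eval_smul, smul_eq_mul, mul_assoc, integral_const_mul, RingHom.id_apply]

lemma moment_apply {w : ℝ → ℝ} (hw : HasMoments w) (p : ℂ[X]) :
    moment w hw p = ∫ x : ℝ, p.eval (x : ℂ) * (w x : ℂ) := rfl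

lemma eval_conjPoly (p : ℂ[X]) (x : ℝ) :
    (conjPoly p).eval (x : ℂ) = starRingEnd ℂ (p.eval (x : ℂ)) := by
  conv_lhs => rw [← Complex.conj_ofReal x]
  exact eval_map_apply (starRingEnd ℂ) (x : ℂ)

/-- Nonnegative functions that are positive on an open set. -/
def IsPosWeight (w : ℝ → ℝ) : Prop :=
  (∀ᵐ x, 0 ≤ w x) ∧ ∃ I : Set ℝ, IsOpen I ∧ I.Nonempty ∧ ∀ᵐ x, x ∈ I → 0 < w x

lemma moment_mul_conj {w : ℝ → ℝ} (hw : HasMoments w) (p : ℂ[X]) :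
    moment w hw (p * conjPoly p) = ((∫ x : ℝ, Complex.normSq (p.eval (x : ℂ)) * w x : ℝ) : ℂ) := by
  refine (moment_apply hw _).trans (Eq.trans ?_ (integral_ofReal (𝕜 := ℂ)))
  refine integral_congr_ae (Filter.Eventually.of_forall fun x => ?_)
  simp only [eval_mul, eval_conjPoly, Complex.mul_conj]
  push_cast; rfl

lemma isPositive_moment {w : ℝ → ℝ} (hw : HasMoments w) (hp : IsPosWeight w) :
    IsPositive (moment w hw) where
  real p := by
    rw [moment_apply, moment_apply, ← integral_conj]
    simp only [eval_conjPoly, map_mul, Complex.conj_ofReal]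
  nonneg p := by
    rw [moment_mul_conj, Complex.ofReal_re]
    refine integral_nonneg_of_ae ?_
    filter_upwards [hp.1] with x hx
    exact mul_nonneg (Complex.normSq_nonneg _) hx
  definite p h := by
    have hint := hw.integrable (p * conjPoly p)
    rw [moment_mul_conj, Complex.ofReal_eq_zero, integral_eq_zero_iff_of_nonneg_ae] at h
    · obtain ⟨I, hI, hne, hpos⟩ := hp.2
      by_contra hp0
      have hfin : {x : ℝ | p.eval (x : ℂ) = 0}.Finite := by
        refine Set.Finite.of_finite_image (f := fun x : ℝ => (x : ℂ)) ?_
          Complex.ofReal_injective.injOn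
        refine (p.roots.toFinset.finite_toSet).subset ?_
        rintro _ ⟨x, hx, rfl⟩
        simpa [hp0] using hx
      -- Almost everywhere on `I` the weight is positive and `|p|² w = 0`, so `I` lies, up to null
      -- sets, in the finite zero set of `p`.
      have h0 : volume I = 0 := by
        refine measure_mono_null (t := {x : ℝ | p.eval (x : ℂ) = 0} ∪
          ({x : ℝ | ¬ (x ∈ I → 0 < w x)} ∪
            {x : ℝ | ¬ (Complex.normSq (p.eval (x : ℂ)) * w x = 0)})) ?_ ?_
        · intro x hx
          by_contra hcon
          simp only [Set.mem_union, Set.mem_ofPred_eq, not_or, not_not] at hcon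
          obtain ⟨h1, h2, h3⟩ := hcon
          rcases mul_eq_zero.1 h3 with h3 | h3
          · exact h1 (Complex.normSq_eq_zero.1 h3)
          · exact (h2 hx).ne' h3
        · exact measure_union_null (hfin.measure_zero volume) (measure_union_null hpos h)
      exact (hI.measure_pos volume hne).ne' h0
    · filter_upwards [hp.1] with x hx
      exact mul_nonneg (Complex.normSq_nonneg _) hx
    · refine hint.re.congr (Filter.Eventually.of_forall fun x => ?_)
      simp only [eval_mul, eval_conjPoly, Complex.mul_conj]
      rw [← Complex.ofReal_mul]
      exact Complex.ofReal_re _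

lemma IsScalarWeight.hasMoments {w : ℝ → ℝ} (h : IsScalarWeight w) : HasMoments w := fun n => by
  simpa using h.2 n 0 0

lemma IsScalarWeight.isPosWeight {w : ℝ → ℝ} (h : IsScalarWeight w) : IsPosWeight w := by
  obtain ⟨⟨I, hI, -, hne, -, hpos, hzero⟩, -⟩ := h
  rw [ae_restrict_iff' hI.measurableSet] at hpos
  have hpos' : ∀ᵐ x, x ∈ I → 0 < w x := by
    filter_upwards [hpos] with x hx hxI
    have := (hx hxI).diag_pos (i := 0)
    rw [Matrix.diagonal_apply_eq] at this
    exact_mod_cast this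
  refine ⟨?_, I, hI, hne, hpos'⟩
  filter_upwards [hpos'] with x hx
  by_cases hxI : x ∈ I
  · exact (hx hxI).le
  · have := congrFun (congrFun (hzero x hxI) 0) 0
    change (w x : ℂ) = 0 at this
    exact (Complex.ofReal_eq_zero.1 this).ge

/-! ### The matrix inner product in terms of moments -/

lemma evalReal_mul (P Q : MatPoly N) (x : ℝ) :
    MatPoly.evalReal (P * Q) x = P.evalReal x * Q.evalReal x :=
  Matrix.map_mul (f := evalRingHom (x : ℂ))

lemma isRepresented_of_factor {W : ℝ → Matrix (Fin N) (Fin N) ℂ} {w : Fin N → ℝ → ℝ}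
    (hw : ∀ j, HasMoments (w j)) {T : MatPoly N} (hT : T.map conjPoly = T)
    (hW : ∀ x, W x = T.evalReal x * directSum w x * (T.evalReal x).conjTranspose) :
    IsRepresented W (fun j => moment (w j) (hw j)) T := by
  intro P Q i k
  have hpt : ∀ x : ℝ, (P.evalReal x * W x * (Q.evalReal x).conjTranspose) i k =
      ∑ j, (Matrix.vecMul (P i) T j * Matrix.vecMul (conjRow (Q k)) T j).eval (x : ℂ) *
        (w j x : ℂ) := by
    intro x
    have e : P.evalReal x * W x * (Q.evalReal x).conjTranspose =
        (MatPoly.evalReal (P * T) x * directSum w x) *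
          (MatPoly.evalReal (Q * T) x).conjTranspose := by
      rw [hW, evalReal_mul, evalReal_mul, Matrix.conjTranspose_mul]
      simp only [mul_assoc]
    rw [e, Matrix.mul_apply]
    refine Finset.sum_congr rfl fun j _ => ?_
    rw [directSum, Matrix.mul_diagonal, Matrix.conjTranspose_apply, ← conjRow_vecMul _ hT, eval_mul]
    change _ * _ * starRingEnd ℂ (eval (x : ℂ) (Matrix.vecMul (Q k) T j)) = _
    rw [conjRow, eval_conjPoly, mul_right_comm]
    rfl
  rw [innerW, Matrix.of_apply, rowForm_apply]
  simp only [hpt, moment_apply]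
  exact integral_finsetSum _ fun j _ => (hw j).integrable _

/-! ### Direct sums of scalar weights -/

lemma IsMonicOrthogonalSeq.isMonicSeq {W : ℝ → Matrix (Fin N) (Fin N) ℂ} {P : ℕ → MatPoly N}
    (h : IsMonicOrthogonalSeq W P) : IsMonicSeq P := ⟨h.1.1, h.2⟩

lemma IsMonicOrthogonalSeq.isRowOrthogonal {W : ℝ → Matrix (Fin N) (Fin N) ℂ}
    {P : ℕ → MatPoly N} (h : IsMonicOrthogonalSeq W P) {l : Fin N → ℂ[X] →ₗ[ℂ] ℂ} {T : MatPoly N}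
    (hW : IsRepresented W l T) : IsRowOrthogonal l T P :=
  isRowOrthogonal_of_pairwise h.isMonicSeq fun n m hnm i k => by
    rw [← hW, h.1.2.2 n m hnm]; rfl

lemma one_map_conjPoly : (1 : MatPoly N).map conjPoly = 1 :=
  Matrix.map_one _ (map_zero _) (map_one _)

/-- Monic orthogonal polynomials of a direct sum are diagonal. -/
lemma IsRowOrthogonal.diagonal {l : Fin N → ℂ[X] →ₗ[ℂ] ℂ} (hl : ∀ j, IsPositive (l j))
    {P : ℕ → MatPoly N} (hP : IsMonicSeq P) (ho : IsRowOrthogonal l 1 P) (n : ℕ) {i j : Fin N}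
    (hij : i ≠ j) : P n i j = 0 := by
  -- The leading coefficient is the identity, so an off-diagonal entry has degree less than `n` and
  -- its conjugate is an admissible test row.
  have hdeg : RowDegLT n (singleRow j (conjPoly (P n i j))) := by
    rw [rowDegLT_iff]
    intro k m hm
    by_cases hk : k = j
    · subst hk
      rw [singleRow_same, coeff_conjPoly]
      rcases hm.eq_or_lt with rfl | hm
      · rw [hP.coeff, Matrix.one_apply_ne hij, map_zero]
      · rw [(hP.rowDegLT n i).coeff hm, map_zero]
    · rw [singleRow_of_ne hk, coeff_zero]
  have h := ho n i _ hdeg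
  rw [rowForm_apply, Matrix.vecMul_one, Matrix.vecMul_one, Finset.sum_eq_single j
    (fun k _ hk => by rw [singleRow_of_ne hk, mul_zero, map_zero])
    (fun h => absurd (Finset.mem_univ j) h), singleRow_same] at h
  exact (hl j).definite _ h

/-! ### The matrix `nilA` -/

lemma isZigzag_nilA (a : ℕ → ℝ) : IsZigzag (nilA N a) := by
  intro i j h
  rw [nilA, Matrix.of_apply] at h
  split_ifs at h with h1 h2
  · exact ⟨h1.1, by rw [h1.2, Nat.even_add_one]; exact not_not.2 h1.1⟩
  · refine ⟨h2.1, fun hj => ?_⟩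
    have := h2.1
    rw [h2.2, Nat.even_add_one] at this
    exact this hj
  · exact absurd rfl h

lemma conj_nilA (a : ℕ → ℝ) (i j : Fin N) : starRingEnd ℂ (nilA N a i j) = nilA N a i j := by
  rw [nilA, Matrix.of_apply]
  split_ifs <;> simp

lemma evalReal_linFactor_nilA (a : ℕ → ℝ) (x : ℝ) :
    MatPoly.evalReal (linFactor (nilA N a)) x = matT N a x := by
  ext1 i j
  change eval (x : ℂ) (linFactor (nilA N a) i j) = _
  rw [linFactor_apply, matT, Matrix.add_apply, Matrix.smul_apply, eval_add, eval_mul, eval_X,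
    eval_C, smul_eq_mul, Matrix.one_apply, Matrix.one_apply]
  split_ifs <;> simp

/-! ### The general theorem -/

/-- The conclusion for weights `T diag(w) T^*` whose diagonal entries satisfy Pearson equations
`(σ w)' = τ w` with compatible degrees and have no rational quotients. -/
theorem main_of_pearson (hN : 1 ≤ N) {a : ℕ → ℝ} (ha : NonzeroParams N a) {w : Fin N → ℝ → ℝ}
    (hm : ∀ j, HasMoments (w j)) (hp : ∀ j, IsPosWeight (w j)) {s₀ s₁ s₂ : ℂ} {t₀ t₁ : Fin N → ℂ}
    (hσ : C s₀ + C s₁ * X + C s₂ * X ^ 2 ≠ 0)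
    (hpearson : ∀ j, IsPearson (C s₀ + C s₁ * X + C s₂ * X ^ 2) (C (t₀ j) + C (t₁ j) * X)
      (moment (w j) (hm j)))
    (hedge : ∀ i j : Fin N, Even (i : ℕ) → ¬ Even (j : ℕ) → 2 * s₂ + (t₁ j - t₁ i) = 0)
    (hrat : ∀ i j, i ≠ j → ∀ g h : ℂ[X],
      (C s₀ + C s₁ * X + C s₂ * X ^ 2) * (derivative h * g - derivative g * h) +
        (C (t₀ j - t₀ i) + C (t₁ j - t₁ i) * X) * (g * h) = 0 → g = 0 ∨ h = 0) :
    SolvesMatrixBochner (twisted a w) ∧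
      (2 ≤ N → ∀ u : Fin N → ℝ → ℝ, (∀ i, IsScalarWeight (u i)) →
        ¬ IsDarbouxTransformOf (twisted a w) (directSum u)) := by
  have hM := isZigzag_nilA (N := N) a
  have hT := linFactor_map_conj (conj_nilA (N := N) a)
  have hfac : IsFactored (fun j => moment (w j) (hm j)) (linFactor (nilA N a))
      (linFactor (-nilA N a)) :=
    ⟨fun j => isPositive_moment (hm j) (hp j), hT, hM.linFactor_mul⟩
  have hrep : IsRepresented (twisted a w) (fun j => moment (w j) (hm j)) (linFactor (nilA N a)) :=
    isRepresented_of_factor hm hT fun x => by rw [evalReal_linFactor_nilA]; rfl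
  constructor
  -- For `i` even and `j` odd, `cⱼ - cᵢ = -t₁ j` cancels the linear term of `τⱼ`, and `hedge`
  -- cancels the quadratic term of `2σ + X(τⱼ - τᵢ)`.
  · refine solvesMatrixBochner_of_pearson hN hrep hM hfac hpearson hσ
      (c := fun j => if Even (j : ℕ) then 0 else -C (t₁ j)) (natDegree_bochnerCoeff ?_ ?_ ?_ ?_ ?_)
    · compute_degree
    · intro j; compute_degree
    · intro j; split_ifs <;> simp
    · intro i j hij
      have h := hedge i j (hM i j hij).1 (hM i j hij).2
      have e : 2 * (C s₀ + C s₁ * X + C s₂ * X ^ 2) +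
          X * (C (t₀ j) + C (t₁ j) * X - (C (t₀ i) + C (t₁ i) * X)) =
          C (2 * s₀) + C (2 * s₁ + t₀ j - t₀ i) * X + C (2 * s₂ + (t₁ j - t₁ i)) * X ^ 2 := by
        simp only [map_add, map_sub, map_mul, map_ofNat]; ring
      rw [e, h]
      simp only [C_0, zero_mul, add_zero]
      compute_degree
    · intro i j hij
      rw [if_pos (hM i j hij).1, if_neg (hM i j hij).2]
      have e : C (t₀ j) + C (t₁ j) * X + X * (-C (t₁ j) - 0) = C (t₀ j) := by ring
      rw [e, natDegree_C]
  · rintro h2 u hu ⟨P, P', hP, hP', D, D', F, F', K, K', -, -, -, -, hK, hK', hPD, hPD'⟩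
    have hum : ∀ j, HasMoments (u j) := fun j => (hu j).hasMoments
    have hup : ∀ j, IsPositive (moment (u j) (hum j)) := fun j =>
      isPositive_moment _ (hu j).isPosWeight
    have hurep : IsRepresented (directSum u) (fun j => moment (u j) (hum j)) 1 :=
      isRepresented_of_factor hum one_map_conjPoly fun x => by
        have : MatPoly.evalReal (1 : MatPoly N) x = 1 :=
          Matrix.map_one _ (eval_zero) (eval_one)
        rw [this, Matrix.conjTranspose_one, one_mul, mul_one]
    have hdiag : ∀ n i j, i ≠ j → P n i j = 0 := fun n i j hij =>
      (hP.isRowOrthogonal hurep).diagonal hup hP.isMonicSeq n hij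
    have hind : AreIndependent (fun j => moment (w j) (hm j)) := by
      intro i j hij E hE hadj
      refine hE.eq_zero_of_adjointable hσ (hpearson j) (hpearson i)
        (isPositive_moment (hm j) (hp j)) (fun g h hgh => hrat i j hij g h ?_) hadj
      rw [← hgh]
      simp only [map_sub]; ring
    -- The first link suffices: row `0` of `A` has `a₁` as its only nonzero entry, and row `1` is
    -- zero.
    let i₀ : Fin N := ⟨0, by omega⟩
    let i₁ : Fin N := ⟨1, by omega⟩
    have hi : i₀ ≠ i₁ := by simp [i₀, i₁]
    have ha1 : (a 1 : ℂ) ≠ 0 := by exact_mod_cast ha 1 le_rfl (by omega)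
    have hM0 : ∀ k, nilA N a i₀ k = if k = i₁ then (a 1 : ℂ) else 0 := by
      intro k
      by_cases hk : k = i₁
      · subst hk; simp [nilA, i₀, i₁]
      · have : (k : ℕ) ≠ 1 := fun h => hk (Fin.ext h)
        simp [nilA, i₀, hk, this]
    have hM1 : ∀ k, nilA N a i₁ k = 0 := by
      intro k; simp [nilA, i₁]
    refine not_all_symbols hi hK hK' fun s => ?_
    obtain ⟨B, hBd, hB⟩ := exists_rankOne_operators hP'.isMonicSeq hdiag hPD hPD' s
    exact exists_eigenvalue_symbol hfac hind hi ha1 hM0 hM1 hP'.isMonicSeq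
      (hP'.isRowOrthogonal hrep) hBd (L := fun n => Matrix.of fun i k => K' n i s * K n s k) hB

/-! ### Quotients of weights that are not rational -/

/-- An exponential `e^(dx)` is not rational: `h'g - g'h` has smaller degree than `gh`, so it cannot
cancel `d gh`. -/
lemma eq_zero_or_of_natDegree {g h : ℂ[X]} {d : ℂ} (hd : d ≠ 0)
    (e : derivative h * g - derivative g * h + C d * (g * h) = 0) : g = 0 ∨ h = 0 := by
  by_contra! hgh
  have hgh0 : g * h ≠ 0 := mul_ne_zero hgh.1 hgh.2
  have h1 : derivative h * g - derivative g * h = C (-d) * (g * h) := by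
    rw [map_neg C d]; linear_combination e
  have h2 : (C (-d) * (g * h)).degree = (g * h).degree := degree_C_mul (neg_ne_zero.2 hd)
  have h3 : (derivative h * g - derivative g * h).degree < (g * h).degree := by
    refine (degree_sub_le _ _).trans_lt (max_lt ?_ ?_)
    · rw [mul_comm, degree_mul, degree_mul]
      exact WithBot.add_lt_add_left (degree_ne_bot.2 hgh.1) (degree_derivative_lt hgh.2)
    · rw [degree_mul, degree_mul]
      exact WithBot.add_lt_add_right (degree_ne_bot.2 hgh.2) (degree_derivative_lt hgh.1)
  rw [h1, h2] at h3
  exact lt_irrefl _ h3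

/-- The logarithmic derivative of `h/g` has at `r` the integer residue `n - m`, the difference of
the orders of vanishing. The equation would make `κ(r)(n - m) + θ(r)` vanish. -/
lemma eq_zero_or_of_rootMultiplicity {g h κ θ : ℂ[X]} {r : ℂ}
    (e : (X - C r) * κ * (derivative h * g - derivative g * h) + θ * (g * h) = 0)
    (hr : ∀ m : ℤ, κ.eval r * m + θ.eval r ≠ 0) : g = 0 ∨ h = 0 := by
  by_contra! hgh
  obtain ⟨g₀, hg, hg0⟩ := exists_eq_pow_rootMultiplicity_mul_and_not_dvd g hgh.1 r
  obtain ⟨h₀, hh, hh0⟩ := exists_eq_pow_rootMultiplicity_mul_and_not_dvd h hgh.2 r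
  set m := rootMultiplicity r g
  set n := rootMultiplicity r h
  have key : ∀ (k : ℕ) (f : ℂ[X]), (X - C r) * derivative ((X - C r) ^ k * f) =
      (X - C r) ^ k * ((k : ℂ[X]) * f + (X - C r) * derivative f) := by
    intro k f
    rw [derivative_mul, derivative_X_sub_C_pow]
    cases k with
    | zero => simp
    | succ k => simp only [Nat.add_sub_cancel, pow_succ, map_natCast]; push_cast; ring
  have kg := key m g₀
  have kh := key n h₀
  rw [← hg] at kg
  rw [← hh] at kh
  have h1 : ((X - C r) ^ m * (X - C r) ^ n) *
      (κ * (((n : ℂ[X]) * h₀ + (X - C r) * derivative h₀) * g₀ -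
        ((m : ℂ[X]) * g₀ + (X - C r) * derivative g₀) * h₀)
        + θ * (g₀ * h₀)) = 0 := by
    rw [← e]
    have e2 : (X - C r) * κ * (derivative h * g - derivative g * h) + θ * (g * h) =
      κ * (((X - C r) * derivative h) * g - ((X - C r) * derivative g) * h) + θ * (g * h) := by ring
    rw [e2, kg, kh]
    conv_rhs => rw [hg, hh]
    ring
  have hX : X - C r ≠ 0 := X_sub_C_ne_zero r
  have h2 := (mul_eq_zero.1 h1).resolve_left (mul_ne_zero (pow_ne_zero _ hX) (pow_ne_zero _ hX))
  have h3 := congrArg (eval r) h2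
  rw [dvd_iff_isRoot, IsRoot] at hg0 hh0
  simp only [eval_add, eval_mul, eval_sub, eval_natCast, eval_X, eval_C, sub_self, zero_mul,
    add_zero, eval_zero] at h3
  have h4 : (g₀.eval r * h₀.eval r) * (κ.eval r * ((n - m : ℤ) : ℂ) + θ.eval r) = 0 := by
    push_cast
    linear_combination h3
  exact mul_ne_zero (mul_ne_zero hg0 hh0) (hr _) h4

lemma hasDerivAt_eval_mul (p : ℂ[X]) {g : ℝ → ℝ} {g' x : ℝ} (hg : HasDerivAt g g' x) :
    HasDerivAt (fun y : ℝ => p.eval (y : ℂ) * (g y : ℂ))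
      ((derivative p).eval (x : ℂ) * (g x : ℂ) + p.eval (x : ℂ) * (g' : ℂ)) x :=
  (p.hasDerivAt (x : ℂ)).comp_ofReal.mul hg.ofReal_comp

/-! ### Hermite weights -/

lemma hasMoments_hermite (b : ℝ) : HasMoments (hermiteWeight b) := by
  intro n
  -- The dominating function comes from `-x² + 2bx ≤ 2b² - x²/2`, which is `(x - 2b)² ≥ 0`.
  have h := ((integrable_rpow_mul_exp_neg_mul_sq (b := 1 / 2) (by norm_num)
    (s := n) (by have := n.cast_nonneg (α := ℝ); linarith)).norm.const_mul
      (Real.exp (2 * b ^ 2)))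
  refine h.mono' (Continuous.aestronglyMeasurable (by unfold hermiteWeight; fun_prop))
    (Filter.Eventually.of_forall fun x => ?_)
  rw [norm_mul, norm_mul, norm_pow, Complex.norm_real, Complex.norm_real, Real.rpow_natCast,
    norm_pow, hermiteWeight, Real.norm_of_nonneg (Real.exp_nonneg _),
    Real.norm_of_nonneg (Real.exp_nonneg _), mul_left_comm, ← Real.exp_add]
  refine mul_le_mul_of_nonneg_left (Real.exp_le_exp.2 ?_) (by positivity)
  nlinarith [sq_nonneg (x - 2 * b)]

lemma isPosWeight_hermite (b : ℝ) : IsPosWeight (hermiteWeight b) :=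
  ⟨Filter.Eventually.of_forall fun _ => (Real.exp_pos _).le, Set.univ, isOpen_univ,
    Set.univ_nonempty, Filter.Eventually.of_forall fun _ _ => Real.exp_pos _⟩

lemma isPearson_hermite (b : ℝ) :
    IsPearson (C 1 + C 0 * X + C 0 * X ^ 2) (C (2 * b : ℂ) + C (-2) * X)
      (moment (hermiteWeight b) (hasMoments_hermite b)) := by
  intro p
  have hd : ∀ x : ℝ, HasDerivAt (fun y : ℝ => p.eval (y : ℂ) * (hermiteWeight b y : ℂ))
      (((C 1 + C 0 * X + C 0 * X ^ 2) * derivative p +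
        (C (2 * b : ℂ) + C (-2) * X) * p).eval (x : ℂ) * (hermiteWeight b x : ℂ)) x := by
    intro x
    have hg : HasDerivAt (hermiteWeight b) (hermiteWeight b x * (-(2 * x) + 2 * b)) x := by
      have h1 : HasDerivAt (fun y : ℝ => -y ^ 2 + 2 * b * y) (-(2 * x) + 2 * b) x := by
        refine (((hasDerivAt_pow 2 x).neg).add ((hasDerivAt_id x).const_mul (2 * b))).congr_deriv ?_
        simp
      exact h1.exp
    refine (hasDerivAt_eval_mul p hg).congr_deriv ?_
    simp
    ring
  exact integral_eq_zero_of_hasDerivAt_of_integrable hd ((hasMoments_hermite b).integrable _)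
    ((hasMoments_hermite b).integrable _)

theorem main_hermite (hN : 1 ≤ N) {W : ℝ → Matrix (Fin N) (Fin N) ℂ} (hW : IsHermiteType W) :
    SolvesMatrixBochner W ∧
      (2 ≤ N → ∀ u : Fin N → ℝ → ℝ, (∀ i, IsScalarWeight (u i)) →
        ¬ IsDarbouxTransformOf W (directSum u)) := by
  obtain ⟨a, b, ha, hb, rfl⟩ := hW
  refine main_of_pearson hN ha (fun j => hasMoments_hermite (b j))
    (fun j => isPosWeight_hermite (b j)) (by simp) (fun j => isPearson_hermite (b j))
    (fun i j _ _ => by simp) fun i j hij g h hgh => ?_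
  have hd : (2 * b j - 2 * b i : ℂ) ≠ 0 := by
    intro h0
    have h1 : (2 * b j - 2 * b i : ℝ) = 0 := by exact_mod_cast h0
    exact hb i j hij (by linarith)
  refine eq_zero_or_of_natDegree hd ?_
  rw [← hgh]
  simp

/-! ### Laguerre weights -/

lemma ofReal_laguerre_eq_indicator (α : ℝ) (f : ℝ → ℂ) :
    (fun x : ℝ => f x * (laguerreWeight α x : ℂ)) =
      (Set.Ioi 0).indicator fun x => f x * ((Real.exp (-x) * x ^ α : ℝ) : ℂ) := by
  ext x
  by_cases hx : 0 < x
  · rw [Set.indicator_of_mem (Set.mem_Ioi.2 hx), laguerreWeight, if_pos hx]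
  · rw [Set.indicator_of_notMem (by simpa using hx), laguerreWeight, if_neg hx]; simp

lemma hasMoments_laguerre {α : ℝ} (hα : -1 < α) : HasMoments (laguerreWeight α) := by
  intro n
  rw [ofReal_laguerre_eq_indicator α fun x => (x : ℂ) ^ n, integrable_indicator_iff measurableSet_Ioi]
  have h := Real.GammaIntegral_convergent (s := α + n + 1)
    (by have := n.cast_nonneg (α := ℝ); linarith)
  refine IntegrableOn.congr_fun h.ofReal (fun x hx => ?_) measurableSet_Ioi
  have hx0 : (0 : ℝ) < x := hx
  have : x ^ (α + n + 1 - 1) = x ^ α * x ^ n := by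
    rw [add_sub_cancel_right, Real.rpow_add hx0, Real.rpow_natCast]
  change ((Real.exp (-x) * x ^ (α + n + 1 - 1) : ℝ) : ℂ) = _
  rw [this]
  push_cast
  ring

lemma isPosWeight_laguerre (α : ℝ) : IsPosWeight (laguerreWeight α) := by
  have h : ∀ x : ℝ, 0 < x → 0 < laguerreWeight α x := fun x hx => by
    rw [laguerreWeight, if_pos hx]; positivity
  refine ⟨Filter.Eventually.of_forall fun x => ?_, Set.Ioi 0, isOpen_Ioi, ⟨1, Set.mem_Ioi.2 one_pos⟩,
    Filter.Eventually.of_forall h⟩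
  by_cases hx : 0 < x
  · exact (h x hx).le
  · rw [laguerreWeight, if_neg hx]

/-- The integrand is the derivative of `σ p w = p e^(-x) x^(α+1)`. This is zero at `0` because `α +
1 > 0`, and tends to zero at infinity because it and its derivative are integrable. -/
lemma isPearson_laguerre {α : ℝ} (hα : -1 < α) :
    IsPearson (C 0 + C 1 * X + C 0 * X ^ 2) (C (α + 1 : ℂ) + C (-1) * X)
      (moment (laguerreWeight α) (hasMoments_laguerre hα)) := by
  intro p
  set q : ℂ[X] := (C 0 + C 1 * X + C 0 * X ^ 2) * derivative p + (C (α + 1 : ℂ) + C (-1) * X) * p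
    with hq
  have hint : ∀ p : ℂ[X], IntegrableOn
      (fun x : ℝ => p.eval (x : ℂ) * ((Real.exp (-x) * x ^ α : ℝ) : ℂ)) (Set.Ioi 0) := by
    intro p
    have := (hasMoments_laguerre hα).integrable p
    rwa [ofReal_laguerre_eq_indicator α fun x => p.eval (x : ℂ),
      integrable_indicator_iff measurableSet_Ioi] at this
  let f : ℝ → ℂ := fun x => p.eval (x : ℂ) * ((Real.exp (-x) * x ^ (α + 1) : ℝ) : ℂ)
  have hpow : ∀ x : ℝ, 0 < x → x ^ (α + 1) = x ^ α * x := fun x hx => by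
    rw [Real.rpow_add hx, Real.rpow_one]
  have hd : ∀ x ∈ Set.Ioi (0 : ℝ), HasDerivAt f
      (q.eval (x : ℂ) * ((Real.exp (-x) * x ^ α : ℝ) : ℂ)) x := by
    intro x hx
    have hx0 : (0 : ℝ) < x := hx
    have h1 : HasDerivAt (fun y : ℝ => Real.exp (-y)) (-Real.exp (-x)) x := by
      simpa using (hasDerivAt_neg x).exp
    have h2 : HasDerivAt (fun y : ℝ => y ^ (α + 1)) ((α + 1) * x ^ α) x := by
      simpa using Real.hasDerivAt_rpow_const (p := α + 1) (Or.inl hx0.ne')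
    refine (hasDerivAt_eval_mul p (h1.mul h2)).congr_deriv ?_
    simp only [Pi.mul_apply]
    rw [hpow x hx0, hq]
    simp
    ring
  have hf : IntegrableOn f (Set.Ioi 0) := by
    refine (hint (p * X)).congr_fun (fun x hx => ?_) measurableSet_Ioi
    simp only [f]
    rw [hpow x hx, eval_mul, eval_X]
    push_cast
    ring
  have hcont : Continuous f := by
    have : Continuous fun x : ℝ => x ^ (α + 1) := Real.continuous_rpow_const (by linarith)
    fun_prop
  have hlim := tendsto_zero_of_hasDerivAt_of_integrableOn_Ioi hd (hint q) hf
  have key := integral_Ioi_of_hasDerivAt_of_tendsto hcont.continuousWithinAt hd (hint q) hlim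
  rw [moment_apply, ofReal_laguerre_eq_indicator α fun x => q.eval (x : ℂ),
    integral_indicator measurableSet_Ioi, key]
  simp [f, Real.zero_rpow (by linarith : α + 1 ≠ 0)]

theorem main_laguerre (hN : 1 ≤ N) {W : ℝ → Matrix (Fin N) (Fin N) ℂ} (hW : IsLaguerreType W) :
    SolvesMatrixBochner W ∧
      (2 ≤ N → ∀ u : Fin N → ℝ → ℝ, (∀ i, IsScalarWeight (u i)) →
        ¬ IsDarbouxTransformOf W (directSum u)) := by
  obtain ⟨a, α, ha, hα, hαα, rfl⟩ := hW
  refine main_of_pearson hN ha (fun j => hasMoments_laguerre (hα j))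
    (fun j => isPosWeight_laguerre (α j)) (by simp) (fun j => isPearson_laguerre (hα j))
    (fun i j _ _ => by simp) fun i j hij g h hgh => ?_
  refine eq_zero_or_of_rootMultiplicity (r := 0) (κ := 1) (θ := C (α j - α i : ℂ)) ?_ fun m hm => ?_
  · rw [← hgh]
    simp
  · refine hαα i j hij m ?_
    simp only [eval_one, one_mul, eval_C] at hm
    have : (m + (α j - α i) : ℝ) = 0 := by exact_mod_cast hm
    linarith

/-! ### Jacobi weights -/

lemma ofReal_jacobi_eq_indicator (α β : ℝ) (f : ℝ → ℂ) :
    (fun x : ℝ => f x * (jacobiWeight α β x : ℂ)) =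
      (Set.Ioo (-1) 1).indicator fun x => f x * (((1 - x) ^ α * (1 + x) ^ β : ℝ) : ℂ) := by
  ext x
  by_cases hx : -1 < x ∧ x < 1
  · rw [Set.indicator_of_mem (Set.mem_Ioo.2 hx), jacobiWeight, if_pos hx]
  · rw [Set.indicator_of_notMem (by simpa using hx), jacobiWeight, if_neg hx]; simp

lemma intervalIntegrable_jacobi {α β : ℝ} (hα : -1 < α) (hβ : -1 < β) :
    IntervalIntegrable (fun x : ℝ => (1 - x) ^ α * (1 + x) ^ β) volume (-1) 1 := by
  -- On each half of the interval only one of the two factors can be singular; the other is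
  -- continuous there.
  have h1 : IntervalIntegrable (fun x : ℝ => (1 + x) ^ β) volume (-1) 0 := by
    simpa using (intervalIntegral.intervalIntegrable_rpow' (a := 0) (b := 1) hβ).comp_add_left 1
  have h2 : IntervalIntegrable (fun x : ℝ => (1 - x) ^ α) volume 0 1 := by
    simpa using (intervalIntegral.intervalIntegrable_rpow' (a := 1) (b := 0) hα).comp_sub_left 1
  refine (h1.continuousOn_mul ?_).trans (h2.mul_continuousOn ?_)
  · refine ContinuousOn.rpow_const (by fun_prop) fun x hx => Or.inl ?_
    rw [Set.uIcc_of_le (by norm_num)] at hx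
    linarith [hx.2]
  · refine ContinuousOn.rpow_const (by fun_prop) fun x hx => Or.inl ?_
    rw [Set.uIcc_of_le (by norm_num)] at hx
    linarith [hx.1]

lemma intervalIntegrable_jacobi_complex {α β : ℝ} (hα : -1 < α) (hβ : -1 < β) :
    IntervalIntegrable (fun x : ℝ => (((1 - x) ^ α * (1 + x) ^ β : ℝ) : ℂ)) volume (-1) 1 :=
  ⟨(intervalIntegrable_jacobi hα hβ).1.ofReal, (intervalIntegrable_jacobi hα hβ).2.ofReal⟩

lemma hasMoments_jacobi {α β : ℝ} (hα : -1 < α) (hβ : -1 < β) :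
    HasMoments (jacobiWeight α β) := by
  intro n
  rw [ofReal_jacobi_eq_indicator α β fun x => (x : ℂ) ^ n,
    integrable_indicator_iff measurableSet_Ioo]
  have h : IntervalIntegrable (fun x : ℝ => (x : ℂ) ^ n * (((1 - x) ^ α * (1 + x) ^ β : ℝ) : ℂ))
      volume (-1) 1 :=
    (intervalIntegrable_jacobi_complex hα hβ).continuousOn_mul (by fun_prop)
  exact ((intervalIntegrable_iff_integrableOn_Ioo_of_le (by norm_num)).1 h)

lemma isPosWeight_jacobi (α β : ℝ) : IsPosWeight (jacobiWeight α β) := by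
  have h : ∀ x : ℝ, x ∈ Set.Ioo (-1 : ℝ) 1 → 0 < jacobiWeight α β x := fun x hx => by
    rw [jacobiWeight, if_pos (Set.mem_Ioo.1 hx)]
    exact mul_pos (Real.rpow_pos_of_pos (by linarith [hx.2]) _)
      (Real.rpow_pos_of_pos (by linarith [hx.1]) _)
  refine ⟨Filter.Eventually.of_forall fun x => ?_, Set.Ioo (-1) 1, isOpen_Ioo, ⟨0, by simp⟩,
    Filter.Eventually.of_forall h⟩
  by_cases hx : -1 < x ∧ x < 1
  · exact (h x hx).le
  · rw [jacobiWeight, if_neg hx]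

lemma isPearson_jacobi {α β : ℝ} (hα : -1 < α) (hβ : -1 < β) :
    IsPearson (C 1 + C 0 * X + C (-1) * X ^ 2) (C (β - α : ℂ) + C (-(α + β + 2) : ℂ) * X)
      (moment (jacobiWeight α β) (hasMoments_jacobi hα hβ)) := by
  intro p
  set q : ℂ[X] := (C 1 + C 0 * X + C (-1) * X ^ 2) * derivative p +
    (C (β - α : ℂ) + C (-(α + β + 2) : ℂ) * X) * p with hq
  have hint : IntervalIntegrable
      (fun x : ℝ => q.eval (x : ℂ) * (((1 - x) ^ α * (1 + x) ^ β : ℝ) : ℂ)) volume (-1) 1 :=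
    (intervalIntegrable_jacobi_complex hα hβ).continuousOn_mul
      (q.continuous.comp Complex.continuous_ofReal).continuousOn
  let f : ℝ → ℂ := fun x => p.eval (x : ℂ) * (((1 - x) ^ (α + 1) * (1 + x) ^ (β + 1) : ℝ) : ℂ)
  have hd : ∀ x ∈ Set.Ioo (-1 : ℝ) 1, HasDerivAt f
      (q.eval (x : ℂ) * (((1 - x) ^ α * (1 + x) ^ β : ℝ) : ℂ)) x := by
    intro x hx
    have hx1 : 0 < 1 - x := by linarith [hx.2]
    have hx2 : 0 < 1 + x := by linarith [hx.1]
    have h1 : HasDerivAt (fun y : ℝ => (1 - y) ^ (α + 1)) (-((α + 1) * (1 - x) ^ α)) x := by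
      have := ((hasDerivAt_id x).const_sub 1).rpow_const (p := α + 1) (Or.inl hx1.ne')
      refine this.congr_deriv ?_
      simp only [id, add_sub_cancel_right]
      ring
    have h2 : HasDerivAt (fun y : ℝ => (1 + y) ^ (β + 1)) ((β + 1) * (1 + x) ^ β) x := by
      have := ((hasDerivAt_id x).const_add 1).rpow_const (p := β + 1) (Or.inl hx2.ne')
      simpa using this
    refine (hasDerivAt_eval_mul p (h1.mul h2)).congr_deriv ?_
    simp only [Pi.mul_apply]
    rw [Real.rpow_add hx1, Real.rpow_one, Real.rpow_add hx2, Real.rpow_one, hq]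
    simp
    ring
  have hcont : Continuous f := by
    have h1 : Continuous fun x : ℝ => (1 - x) ^ (α + 1) :=
      (Real.continuous_rpow_const (by linarith)).comp (by fun_prop)
    have h2 : Continuous fun x : ℝ => (1 + x) ^ (β + 1) :=
      (Real.continuous_rpow_const (by linarith)).comp (by fun_prop)
    fun_prop
  have key := intervalIntegral.integral_eq_sub_of_hasDerivAt_of_le (by norm_num : (-1 : ℝ) ≤ 1)
    hcont.continuousOn hd hint
  rw [moment_apply, ofReal_jacobi_eq_indicator α β fun x => q.eval (x : ℂ),
    integral_indicator measurableSet_Ioo, ← integral_Ioc_eq_integral_Ioo,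
    ← intervalIntegral.integral_of_le (by norm_num), key]
  simp [f, Real.zero_rpow (by linarith : α + 1 ≠ 0), Real.zero_rpow (by linarith : β + 1 ≠ 0)]

theorem main_jacobi (hN : 1 ≤ N) {W : ℝ → Matrix (Fin N) (Fin N) ℂ} (hW : IsJacobiType W) :
    SolvesMatrixBochner W ∧
      (2 ≤ N → ∀ u : Fin N → ℝ → ℝ, (∀ i, IsScalarWeight (u i)) →
        ¬ IsDarbouxTransformOf W (directSum u)) := by
  obtain ⟨a, α, β, ha, hα, hβ, hαβ, hsum, rfl⟩ := hW
  have hσ : (C 1 + C 0 * X + C (-1) * X ^ 2 : ℂ[X]) ≠ 0 := by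
    intro h
    simpa using congrArg (eval 0) h
  refine main_of_pearson hN ha (fun j => hasMoments_jacobi (hα j) (hβ j))
    (fun j => isPosWeight_jacobi (α j) (β j)) hσ (fun j => isPearson_jacobi (hα j) (hβ j))
    (fun i j hi hj => ?_) fun i j hij g h hgh => ?_
  -- The parameter condition says that `α + β` is two larger at zero-based even positions than at
  -- odd ones, which offsets `2 s₂ = -2`.
  · have h1 := hsum ⟨0, hN⟩ i rfl
    have h2 := hsum ⟨0, hN⟩ j rfl
    rw [hi.add_one.neg_one_pow] at h1
    rw [(Nat.not_even_iff_odd.1 hj).add_one.neg_one_pow] at h2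
    have h3 : 2 * (-1) + (-(α j + β j + 2) - -(α i + β i + 2)) = 0 := by linarith
    exact_mod_cast congrArg (fun x : ℝ => (x : ℂ)) h3
  · rcases hαβ i j hij with hm | hm
    -- Here `1 - x² = (x - 1)·(-(1 + x))`. At `1` both `κ` and `θ` carry a factor `-2`, so a zero
    -- would make the difference of the `α`'s an integer; the endpoint `-1` does the same for the
    -- `β`'s.
    · refine eq_zero_or_of_rootMultiplicity (r := 1) (κ := -(1 + X))
        (θ := C (β j - β i : ℂ) * (1 - X) - C (α j - α i : ℂ) * (1 + X)) ?_ fun m h0 => hm m ?_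
      · rw [← hgh]
        simp only [map_sub, map_add, map_neg, map_ofNat, map_one, map_zero]
        ring
      · simp at h0
        have h1 : -((1 + 1) * m) - (α j - α i) * (1 + 1) = (0 : ℝ) := by
          apply Complex.ofReal_injective
          push_cast
          linear_combination h0
        linarith
    · refine eq_zero_or_of_rootMultiplicity (r := -1) (κ := 1 - X)
        (θ := C (β j - β i : ℂ) * (1 - X) - C (α j - α i : ℂ) * (1 + X)) ?_ fun m h0 => hm m ?_
      · rw [← hgh]
        simp only [map_sub, map_add, map_neg, map_ofNat, map_one, map_zero]
        ring
      · simp at h0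
        have h1 : (1 + 1) * m + (β j - β i) * (1 + 1) = (0 : ℝ) := by
          apply Complex.ofReal_injective
          push_cast
          linear_combination h0
        linarith

end MatrixBochner

end

theorem theorem1p1 (N : ℕ) (hN : 1 ≤ N) (W : ℝ → Matrix (Fin N) (Fin N) ℂ)
    (hW : MatrixBochner.IsHermiteType W ∨ MatrixBochner.IsLaguerreType W ∨
      MatrixBochner.IsJacobiType W) :
    MatrixBochner.SolvesMatrixBochner W ∧
    (2 ≤ N → ∀ w : Fin N → ℝ → ℝ, (∀ i, MatrixBochner.IsScalarWeight (w i)) →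
      ¬ MatrixBochner.IsDarbouxTransformOf W (MatrixBochner.directSum w)) := by
  rcases hW with hW | hW | hW
  · exact MatrixBochner.main_hermite hN hW
  · exact MatrixBochner.main_laguerre hN hW
  · exact MatrixBochner.main_jacobi hN hW
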